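/- A Cantor minimal system $(X,\varphi)$ is a Cantor set $X$ (a non-empty zero-dimensional compact metrizable space without isolated points) together with a homeomorphism $\varphi$ of $X$ all of whose orbits $\{\varphi^n(x):n\in\mathbb Z\}$ are dense. Its topological full group $[[\varphi]]$ is the group of all homeomorphisms $f$ of $X$ for which there is a continuous function $n_f:X\to\mathbb Z$ (unique, since $\varphi$ has no periodic points) with $f(x)=\varphi^{n_f(x)}(x)$ for all $x\in X$. For a $\varphi$-invariant Borel probability measure $\mu$ on $X$, let $[[\varphi]]_0=\{f\in[[\varphi]]:\int_X n_f\,d\mu=0\}$, a subgroup of $[[\varphi]]$ (which does not depend on the choice of $\mu$). For a group $G$, let $D(G)$ be its commutator subgroup. Two systems $(X_1,\varphi_1)$, $(X_2,\varphi_2)$ are flip conjugate if there is a homeomorphism $F:X_1\to X_2$ such that $F\circ\varphi_1\circ F^{-1}$ equals $\varphi_2$ or $\varphi_2^{-1}$. Theorem. Let $(X_1,\varphi_1)$ and $(X_2,\varphi_2)$ be Cantor minimal systems. Then each of the following three statements, taken separately, is equivalent to $\varphi_1$ and $\varphi_2$ being flip conjugate: (1) $D([[\varphi_1]])\cong D([[\varphi_2]])$;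 (2) $[[\varphi_1]]_0\cong[[\varphi_2]]_0$, where $[[\varphi_1]]_0$ and $[[\varphi_2]]_0$ are formed with arbitrary invariant Borel probability measures $\mu_1$ for $\varphi_1$ and $\mu_2$ for $\varphi_2$; (3) $[[\varphi_1]]\cong[[\varphi_2]]$. Here $\cong$ denotes isomorphism of abstract groups. -/

import Mathlib

open MeasureTheory

namespace CantorMinimal

/-- `φ` is minimal: the two-sided `φ`-orbit of every point is dense. Multiplication in the group
`X ≃ₜ X` is composition, so `φ ^ k` is the `k`-th iterate of `φ`. -/
def IsMinimal {X : Type*} [TopologicalSpace X] (φ : X ≃ₜ X) : Prop :=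
  ∀ x : X, Dense {y : X | ∃ k : ℤ, y = (φ ^ k) x}

/-- `n` is a cocycle of `f` over `φ`: `f x = φ ^ (n x) x` for all `x`. If `φ` has no periodic
points (as is the case for a minimal homeomorphism of a Cantor set), then `n` is determined by
`f`. The existence of `n` says that `f` lies in the full group of `φ`. -/
def IsCocycle {X : Type*} [TopologicalSpace X] (φ f : X ≃ₜ X) (n : X → ℤ) : Prop :=
  ∀ x : X, f x = (φ ^ n x) x

theorem IsCocycle.one {X : Type*} [TopologicalSpace X] (φ : X ≃ₜ X) :
    IsCocycle φ 1 (fun _ => 0) := fun x => by simp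

theorem IsCocycle.mul {X : Type*} [TopologicalSpace X] {φ f g : X ≃ₜ X} {m n : X → ℤ}
    (hf : IsCocycle φ f m) (hg : IsCocycle φ g n) :
    IsCocycle φ (f * g) (fun x => m (g x) + n x) := fun x => by
  change f (g x) = _
  rw [hf (g x), zpow_add]
  change _ = (φ ^ m (g x)) ((φ ^ n x) x)
  rw [← hg x]

theorem IsCocycle.inv {X : Type*} [TopologicalSpace X] {φ f : X ≃ₜ X} {n : X → ℤ}
    (hf : IsCocycle φ f n) : IsCocycle φ f⁻¹ (fun x => -n (f⁻¹ x)) := fun x => by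
  have h : x = (φ ^ n (f⁻¹ x)) (f⁻¹ x) := (f.apply_symm_apply x).symm.trans (hf (f⁻¹ x))
  rw [zpow_neg]
  exact ((φ ^ n (f⁻¹ x)).symm_apply_eq.2 h).symm

/-- The topological full group `[[φ]]`: the homeomorphisms of `X` which have a continuous
cocycle over `φ`. -/
def topologicalFullGroup {X : Type*} [TopologicalSpace X] (φ : X ≃ₜ X) : Subgroup (X ≃ₜ X) where
  carrier := {f | ∃ n : X → ℤ, Continuous n ∧ IsCocycle φ f n}
  one_mem' := ⟨fun _ => 0, continuous_const, IsCocycle.one φ⟩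
  mul_mem' := by
    rintro f g ⟨m, hm, hf⟩ ⟨n, hn, hg⟩
    exact ⟨_, (hm.comp g.continuous).add hn, hf.mul hg⟩
  inv_mem' := by
    rintro f ⟨n, hn, hf⟩
    exact ⟨_, (hn.comp (f⁻¹).continuous).neg, hf.inv⟩

theorem measurePreserving_zpow {X : Type*} [TopologicalSpace X] [MeasurableSpace X] [BorelSpace X]
    {φ : X ≃ₜ X} {μ : Measure X} (hμ : MeasurePreserving φ μ μ) (k : ℤ) :
    MeasurePreserving (φ ^ k) μ μ := by
  have hs : MeasurePreserving (φ⁻¹ : X ≃ₜ X) μ μ :=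
    MeasurePreserving.symm φ.toMeasurableEquiv hμ
  induction k with
  | zero => exact MeasurePreserving.id μ
  | succ k ih => rw [zpow_add_one]; exact ih.comp hμ
  | pred k ih => rw [zpow_sub_one]; exact ih.comp hs

theorem measure_eq_tsum_fibres {X : Type*} [MeasurableSpace X] (μ : Measure X) {n : X → ℤ}
    (hn : Measurable n) {S : Set X} (hS : MeasurableSet S) :
    μ S = ∑' k : ℤ, μ (S ∩ n ⁻¹' {k}) := by
  rw [← measure_iUnion]
  · congr 1
    ext x
    simp
  · intro i j hij
    refine Set.disjoint_left.2 ?_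
    rintro x ⟨_, hx⟩ ⟨_, hy⟩
    exact hij (hx.symm.trans hy)
  · exact fun k => hS.inter (hn (measurableSet_singleton k))

/-- A homeomorphism with a continuous cocycle over `φ` preserves every `φ`-invariant measure. -/
theorem IsCocycle.measurePreserving {X : Type*} [TopologicalSpace X] [MeasurableSpace X]
    [BorelSpace X] {φ f : X ≃ₜ X} {n : X → ℤ} (hf : IsCocycle φ f n) (hn : Continuous n)
    {μ : Measure X} (hμ : MeasurePreserving φ μ μ) : MeasurePreserving f μ μ := by
  refine ⟨f.continuous.measurable, Measure.ext fun S hS => ?_⟩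
  have hm : Continuous (fun y => n (f.symm y)) := hn.comp f.symm.continuous
  rw [Measure.map_apply f.continuous.measurable hS,
    measure_eq_tsum_fibres μ hn.measurable (f.continuous.measurable hS),
    measure_eq_tsum_fibres μ hm.measurable hS]
  refine tsum_congr fun k => ?_
  have hT : MeasurableSet (S ∩ (fun y => n (f.symm y)) ⁻¹' {k}) :=
    hS.inter (hm.measurable (measurableSet_singleton k))
  rw [← (measurePreserving_zpow hμ k).measure_preimage hT.nullMeasurableSet]
  congr 1
  ext x
  have hfx := hf x
  constructor
  · rintro ⟨h1, h2⟩
    have h3 : n x = k := h2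
    rw [h3] at hfx
    refine ⟨?_, ?_⟩
    · rw [← hfx]; exact h1
    · change n (f.symm ((φ ^ k) x)) = k
      rw [← hfx, f.symm_apply_apply, h3]
  · rintro ⟨h1, h2⟩
    have h3 : n (f.symm ((φ ^ k) x)) = k := h2
    have h4 := hf (f.symm ((φ ^ k) x))
    rw [h3, f.apply_symm_apply] at h4
    have h5 : x = f.symm ((φ ^ k) x) := (φ ^ k).injective h4
    have h6 : n x = k := by rw [← h5] at h3; exact h3
    rw [h6] at hfx
    refine ⟨?_, h6⟩
    change f x ∈ S
    rw [hfx]; exact h1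

theorem integrable_of_continuous_int {X : Type*} [TopologicalSpace X] [CompactSpace X]
    [MeasurableSpace X] [BorelSpace X] (μ : Measure X) [IsProbabilityMeasure μ] {n : X → ℤ}
    (hn : Continuous n) : Integrable (fun x => (n x : ℝ)) μ := by
  have hc : Continuous (fun x => (n x : ℝ)) := continuous_of_discreteTopology.comp hn
  obtain ⟨C, hC⟩ := isCompact_univ.exists_bound_of_continuousOn hc.continuousOn
  exact Integrable.of_bound hc.measurable.aestronglyMeasurable C
    (Filter.Eventually.of_forall fun x => hC x (Set.mem_univ x))

/-- The group `[[φ]]₀`, formed with a `φ`-invariant Borel probability measure `μ`: the elements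
of `[[φ]]` whose (continuous) cocycle has `μ`-integral zero. -/
def topologicalFullGroupZero {X : Type*} [TopologicalSpace X] [CompactSpace X]
    [MeasurableSpace X] [BorelSpace X] (φ : X ≃ₜ X) (μ : Measure X) [IsProbabilityMeasure μ]
    (hμ : MeasurePreserving φ μ μ) : Subgroup (X ≃ₜ X) where
  carrier := {f | ∃ n : X → ℤ, Continuous n ∧ IsCocycle φ f n ∧ ∫ x, (n x : ℝ) ∂μ = 0}
  one_mem' := ⟨fun _ => 0, continuous_const, IsCocycle.one φ, by simp⟩
  mul_mem' := by
    rintro f g ⟨m, hm, hf, hm0⟩ ⟨n, hn, hg, hn0⟩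
    refine ⟨fun x => m (g x) + n x, (hm.comp g.continuous).add hn, hf.mul hg, ?_⟩
    have h1 : ∫ x, (m (g x) : ℝ) ∂μ = ∫ x, (m x : ℝ) ∂μ :=
      (hg.measurePreserving hn hμ).integral_comp g.measurableEmbedding (fun x => (m x : ℝ))
    push_cast
    have h2 : Integrable (fun x => (m (g x) : ℝ)) μ :=
      integrable_of_continuous_int μ (hm.comp g.continuous)
    rw [integral_add h2 (integrable_of_continuous_int μ hn), h1, hm0, hn0, add_zero]
  inv_mem' := by
    rintro f ⟨n, hn, hf, hn0⟩
    refine ⟨fun x => -n (f⁻¹ x), (hn.comp (f⁻¹).continuous).neg, hf.inv, ?_⟩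
    have h1 : ∫ x, (n ((f⁻¹ : X ≃ₜ X) x) : ℝ) ∂μ = ∫ x, (n x : ℝ) ∂μ :=
      (hf.inv.measurePreserving (hn.comp (f⁻¹).continuous).neg hμ).integral_comp
        (f⁻¹).measurableEmbedding (fun x => (n x : ℝ))
    push_cast
    rw [integral_neg, h1, hn0, neg_zero]

/-- Flip conjugacy: some homeomorphism conjugates `φ₁` to `φ₂` or to its inverse. -/
def FlipConjugate {X₁ X₂ : Type*} [TopologicalSpace X₁] [TopologicalSpace X₂]
    (φ₁ : X₁ ≃ₜ X₁) (φ₂ : X₂ ≃ₜ X₂) : Prop :=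
  ∃ F : X₁ ≃ₜ X₂, (∀ y : X₂, F (φ₁ (F.symm y)) = φ₂ y) ∨
    (∀ y : X₂, F (φ₁ (F.symm y)) = φ₂.symm y)

end CantorMinimal

/-!
The three groups attached to a Cantor minimal system all lie between `D([[φ]])` and `[[φ]]`, and
the proof that an isomorphism entails flip conjugacy uses nothing else about them.

*Reconstruction of the space.* A minimal homeomorphism of a Cantor set is free, so each element of
`[[φ]]` has a clopen support. The commutator of two exchanges `A ↔ φ ^ i (A)` and `A ↔ φ ^ j (A)`
is a `3`-cycle of clopen sets, so `D([[φ]])` contains elements of small support moving any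
prescribed point (`exists_threeCycle`). For such groups Rubin's relation of algebraic disjointness,
in the form used by Belk, Elliott and Matucci, expresses inclusion of supports in terms of the
multiplication alone (`IsRich.algSupported_iff`). Hence an isomorphism `α` preserves inclusion of
supports, and a compactness argument attaches to each point `x` the unique point which is moved by
`α g` exactly when `g` moves `x`. The resulting map is a homeomorphism which implements `α`
(`IsRich.exists_homeomorph`).

*From full groups to flip conjugacy.* Locally `φ` agrees with a `3`-cycle, so the homeomorphism
carries `φ₁` to a minimal `ψ ∈ [[φ₂]]`, and `φ₂ ∈ [[ψ]]` by symmetry. Write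
`ψ ^ k x = φ₂ ^ (a k x) x`. The permutation `k ↦ a k x` of `ℤ` and its inverse have bounded
increments, so it preserves or reverses the two ends of `ℤ`, and by minimality the same alternative
holds for all `x`. In the first case let `d x` be the number of points of the forward `ψ`-orbit of
`x` missing from the forward `φ₂`-orbit, minus the number of points missing the other way round.
Then `d` is continuous, `d (ψ x) = d x - 1 + a 1 x`, and `x ↦ φ₂ ^ (-d x) x` conjugates `ψ` to
`φ₂`; in the second case the same applies to `φ₂⁻¹` (`IsMinimal.flipConjugate`).

*From flip conjugacy to isomorphism.* Conjugation by the homeomorphism maps `[[φ₁]]` onto `[[φ₂]]`.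
For `[[φ]]₀` one also needs that this group does not depend on the invariant measure: the integral
of the cocycle of `f` is the net flow across the origin of the permutation of `ℤ` which `f` induces
on an orbit, and this flow is a continuous invariant function, hence constant
(`IsMinimal.exists_integral_eq`).
-/

namespace CantorMinimal
open Topology Set
open scoped commutatorElement

/-! ### Free homeomorphisms and their cocycles -/

section Basic

variable {X : Type*} [TopologicalSpace X]

/-- `φ` has no periodic points, i.e. the `ℤ`-action generated by `φ` is free. -/
def IsFree (φ : X ≃ₜ X) : Prop := ∀ (k : ℤ) (x : X), (φ ^ k) x = x → k = 0

theorem zpow_add_apply (φ : X ≃ₜ X) (m n : ℤ) (x : X) :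
    (φ ^ (m + n)) x = (φ ^ m) ((φ ^ n) x) := by
  rw [zpow_add]; rfl

theorem apply_zpow_apply (φ : X ≃ₜ X) (n : ℤ) (x : X) : φ ((φ ^ n) x) = (φ ^ (1 + n)) x := by
  rw [zpow_add_apply, zpow_one]

theorem zpow_neg_apply (φ : X ≃ₜ X) (m : ℤ) (x : X) :
    (φ ^ (-m)) x = (φ ^ m).symm x := by
  rw [zpow_neg]; rfl

theorem zpow_apply_of_apply_eq {f : X ≃ₜ X} {x : X} (h : f x = x) (k : ℤ) : (f ^ k) x = x := by
  induction k with
  | zero => simp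
  | succ k ih => rw [zpow_add_apply, zpow_one, h, ih]
  | pred k ih =>
    rw [sub_eq_add_neg, zpow_add_apply, zpow_neg_apply f 1, zpow_one]
    rwa [show f.symm x = x from f.symm_apply_eq.2 h.symm]

theorem IsFree.zpow_injective {φ : X ≃ₜ X} (hφ : IsFree φ) {m n : ℤ} {x : X}
    (h : (φ ^ m) x = (φ ^ n) x) : m = n := by
  have : (φ ^ (-n + m)) x = x := by
    rw [zpow_add_apply, h, ← zpow_add_apply]; simp
  have := hφ _ _ this
  omega

theorem infinite_of_mem_nhds_of_perfectSpace [T1Space X] [PerfectSpace X] {x : X} {U : Set X}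
    (hU : U ∈ 𝓝 x) : U.Infinite := by
  have h : AccPt x (Filter.principal (univ : Set X)) :=
    PerfectSpace.univ_preperfect x (mem_univ x)
  have : (𝓝[≠] x).NeBot := by simpa [AccPt] using h
  exact infinite_of_mem_nhds x hU

/-- A periodic orbit would be a finite dense set. -/
theorem IsMinimal.isFree [T1Space X] [PerfectSpace X] {φ : X ≃ₜ X} (hφ : IsMinimal φ) :
    IsFree φ := by
  intro k x hk
  by_contra hk0
  have hfin : {y : X | ∃ k : ℤ, y = (φ ^ k) x}.Finite := by
    refine ((finite_Ico (0 : ℤ) |k|).image fun m => (φ ^ m) x).subset ?_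
    rintro y ⟨m, rfl⟩
    refine ⟨m % k, ⟨Int.emod_nonneg _ hk0, Int.emod_lt_abs _ hk0⟩, ?_⟩
    have h := zpow_apply_of_apply_eq hk (m / k)
    conv_rhs => rw [← Int.emod_add_mul_ediv m k, zpow_add_apply, zpow_mul, h]
  have huniv : {y : X | ∃ k : ℤ, y = (φ ^ k) x} = univ := by
    rw [← hfin.isClosed.closure_eq, (hφ x).closure_eq]
  exact infinite_of_mem_nhds_of_perfectSpace (Filter.univ_mem (f := 𝓝 x)) (huniv ▸ hfin)

/-- Orbits of a minimal homeomorphism return to each open set at infinitely many times. -/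
theorem IsMinimal.exists_zpow_mem [T1Space X] [PerfectSpace X] {φ : X ≃ₜ X} (hφ : IsMinimal φ)
    {U : Set X} (hU : IsOpen U) (hne : U.Nonempty) (x : X) (S : Finset ℤ) :
    ∃ k ∉ S, (φ ^ k) x ∈ U := by
  obtain ⟨y, hy⟩ := hne
  have hfin : ((fun m : ℤ => (φ ^ m) x) '' (S : Set ℤ)).Finite := S.finite_toSet.image _
  have hne' : (U \ ((fun m : ℤ => (φ ^ m) x) '' (S : Set ℤ))).Nonempty :=
    ((infinite_of_mem_nhds_of_perfectSpace (hU.mem_nhds hy)).sdiff hfin).nonempty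
  obtain ⟨z, hz, k, rfl⟩ := (hφ x).inter_open_nonempty _ (hU.sdiff hfin.isClosed) hne'
  exact ⟨k, fun hk => hz.2 ⟨k, hk, rfl⟩, hz.1⟩

theorem eventually_eq_of_continuous_int {n : X → ℤ} (hn : Continuous n) (x : X) :
    ∀ᶠ y in 𝓝 x, n y = n x :=
  ((isOpen_discrete {n x}).preimage hn).mem_nhds rfl

theorem continuous_of_eventually_eq {n : X → ℤ} (h : ∀ x, ∀ᶠ y in 𝓝 x, n y = n x) :
    Continuous n :=
  continuous_iff_continuousAt.2 fun x =>
    (continuousAt_const (y := n x)).congr ((h x).mono fun _ hy => hy.symm)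

theorem continuous_zpow_apply (φ : X ≃ₜ X) {n : X → ℤ} (hn : Continuous n) :
    Continuous fun x => (φ ^ n x) x :=
  continuous_iff_continuousAt.2 fun x => (φ ^ n x).continuous.continuousAt.congr <|
    (eventually_eq_of_continuous_int hn x).mono fun y hy => by
      simp only [hy]

theorem continuous_int_ite {A : Set X} (hA : IsClopen A) [DecidablePred (· ∈ A)] {m n : X → ℤ}
    (hm : Continuous m) (hn : Continuous n) : Continuous fun x => if x ∈ A then m x else n x :=
  continuous_if (fun a ha => by simp [show {x | x ∈ A} = A from rfl, hA.frontier_eq] at ha)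
    hm.continuousOn hn.continuousOn

/-- Membership in `[[φ]]` is a local property. -/
theorem IsFree.mem_topologicalFullGroup_of_eventuallyEq {φ f : X ≃ₜ X} (hφ : IsFree φ)
    (h : ∀ x, ∃ g ∈ topologicalFullGroup φ, ∀ᶠ y in 𝓝 x, f y = g y) :
    f ∈ topologicalFullGroup φ := by
  have hpt : ∀ x, ∃ k : ℤ, f x = (φ ^ k) x := fun x => by
    obtain ⟨g, ⟨n, -, hn⟩, hg⟩ := h x
    exact ⟨n x, hg.self_of_nhds.trans (hn x)⟩
  choose n hn using hpt
  refine ⟨n, continuous_of_eventually_eq fun x => ?_, hn⟩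
  obtain ⟨g, ⟨m, hmc, hm⟩, hg⟩ := h x
  have key : ∀ y, f y = g y → n y = m y := fun y hy =>
    hφ.zpow_injective ((hn y).symm.trans (hy.trans (hm y)))
  filter_upwards [hg, eventually_eq_of_continuous_int hmc x] with y hy hy'
  rw [key y hy, hy', key x hg.self_of_nhds]

/-- The set of points moved by `f`, before taking closures. -/
def movedSet (f : X ≃ₜ X) : Set X := {x | f x ≠ x}

theorem mem_movedSet {f : X ≃ₜ X} {x : X} : x ∈ movedSet f ↔ f x ≠ x := Iff.rfl

theorem apply_eq_of_notMem_movedSet {f : X ≃ₜ X} {x : X} (h : x ∉ movedSet f) : f x = x :=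
  not_not.1 h

/-- By freeness, `f` moves exactly the points where its continuous cocycle is nonzero. -/
theorem IsFree.isClopen_movedSet {φ f : X ≃ₜ X} (hφ : IsFree φ)
    (hf : f ∈ topologicalFullGroup φ) : IsClopen (movedSet f) := by
  obtain ⟨n, hn, hfn⟩ := hf
  have : movedSet f = n ⁻¹' {0}ᶜ := by
    ext x
    refine not_congr ⟨fun h => ?_, fun h => ?_⟩
    · exact hφ _ x ((hfn x).symm.trans h)
    · rw [hfn x, show n x = 0 from h]; simp
  rw [this]
  exact (isClopen_discrete _).preimage hn

theorem exists_isOpen_disjoint_image [T2Space X] {f : X ≃ₜ X} {x : X} (h : f x ≠ x) :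
    ∃ V : Set X, IsOpen V ∧ x ∈ V ∧ ∀ y ∈ V, f y ∉ V := by
  obtain ⟨u, v, hu, hv, hxu, hxv, huv⟩ := t2_separation h.symm
  exact ⟨u ∩ f ⁻¹' v, hu.inter (hv.preimage f.continuous), ⟨hxu, hxv⟩,
    fun y hy hy' => disjoint_left.1 huv hy'.1 hy.2⟩

end Basic

/-! ### Small cycles in the commutator subgroup -/

section Cycles

variable {X : Type*} [TopologicalSpace X]

/-- If the clopen set `A` is disjoint from `φ ^ i (A)`, then the involution exchanging `A` and
`φ ^ i (A)` by means of `φ ^ i` belongs to `[[φ]]`. -/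
theorem exists_swap (φ : X ≃ₜ X) {A : Set X} (hA : IsClopen A) {i : ℤ}
    (hi : ∀ y ∈ A, (φ ^ i) y ∉ A) :
    ∃ s ∈ topologicalFullGroup φ, s * s = 1 ∧ (∀ y ∈ A, s y = (φ ^ i) y) ∧
      (∀ y ∈ A, s ((φ ^ i) y) = y) ∧ ∀ y, y ∉ A → (φ ^ (-i)) y ∉ A → s y = y := by
  classical
  let B : Set X := (φ ^ (-i)) ⁻¹' A
  have hB : IsClopen B := hA.preimage (φ ^ (-i)).continuous
  let n : X → ℤ := fun y => if y ∈ A then i else if y ∈ B then -i else 0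
  have hn : Continuous n :=
    continuous_int_ite hA continuous_const (continuous_int_ite hB continuous_const continuous_const)
  let s : X → X := fun y => (φ ^ n y) y
  have h1 : ∀ y ∈ A, s y = (φ ^ i) y := fun y hy => by simp [s, n, hy]
  have hcancel : ∀ y, (φ ^ (-i)) ((φ ^ i) y) = y := fun y => by rw [← zpow_add_apply]; simp
  have hcancel' : ∀ y, (φ ^ i) ((φ ^ (-i)) y) = y := fun y => by rw [← zpow_add_apply]; simp
  have h2 : ∀ y ∈ A, s ((φ ^ i) y) = y := fun y hy => by
    have hb : (φ ^ i) y ∈ B := by change (φ ^ (-i)) ((φ ^ i) y) ∈ A; rwa [hcancel]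
    simp only [s, n, hi y hy, hb, if_true, if_false, hcancel]
  have h3 : ∀ y, y ∉ A → (φ ^ (-i)) y ∉ A → s y = y := fun y hy hy' => by
    have hb : y ∉ B := hy'
    simp [s, n, hy, hb]
  have hinv : Function.Involutive s := fun y => by
    by_cases hy : y ∈ A
    · rw [h1 y hy, h2 y hy]
    · by_cases hy' : (φ ^ (-i)) y ∈ A
      · have h4 : s y = (φ ^ (-i)) y := by conv_lhs => rw [← hcancel' y, h2 _ hy']
        rw [h4, h1 _ hy', hcancel']
      · rw [h3 y hy hy', h3 y hy hy']
  let S : X ≃ₜ X :=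
    { hinv.toPerm s with
      continuous_toFun := continuous_zpow_apply φ hn
      continuous_invFun := continuous_zpow_apply φ hn }
  exact ⟨S, ⟨n, hn, fun _ => rfl⟩, Homeomorph.ext hinv, h1, h2, h3⟩

/-- If `x`, `φ ^ i x` and `φ ^ j x` are distinct points of an open set `U`, then there is a
`3`-cycle of clopen sets in `D([[φ]])` which is supported in `U` and permutes these three points
cyclically. It is the commutator of two exchanges which have one clopen set in common. -/
theorem exists_threeCycle [CompactSpace X] [T2Space X] [TotallyDisconnectedSpace X] {φ : X ≃ₜ X}
    (hφ : IsFree φ) {U : Set X} (hU : IsOpen U) {x : X} {i j : ℤ} (hx : x ∈ U)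
    (hix : (φ ^ i) x ∈ U) (hjx : (φ ^ j) x ∈ U) (hi : i ≠ 0) (hj : j ≠ 0) (hij : i ≠ j) :
    ∃ c ∈ ⁅topologicalFullGroup φ, topologicalFullGroup φ⁆, movedSet c ⊆ U ∧
      (∀ᶠ y in 𝓝 x, c y = (φ ^ i) y) ∧ c ((φ ^ i) x) = (φ ^ j) x ∧ c ((φ ^ j) x) = x := by
  have hne : ∀ k : ℤ, k ≠ 0 → (φ ^ k) x ≠ x := fun k hk h => hk (hφ k x h)
  obtain ⟨V₁, hV₁, hx₁, h₁⟩ := exists_isOpen_disjoint_image (hne i hi)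
  obtain ⟨V₂, hV₂, hx₂, h₂⟩ := exists_isOpen_disjoint_image (hne j hj)
  obtain ⟨V₃, hV₃, hx₃, h₃⟩ := exists_isOpen_disjoint_image (hne (j - i) (by omega))
  obtain ⟨A, hA, hxA, hAV⟩ := compact_exists_isClopen_in_isOpen
    (U := (V₁ ∩ V₂ ∩ V₃) ∩ (U ∩ (φ ^ i) ⁻¹' U ∩ (φ ^ j) ⁻¹' U))
    (((hV₁.inter hV₂).inter hV₃).inter ((hU.inter (hU.preimage (φ ^ i).continuous)).inter
      (hU.preimage (φ ^ j).continuous)))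
    ⟨⟨⟨hx₁, hx₂⟩, hx₃⟩, ⟨hx, hix⟩, hjx⟩
  have hAi : ∀ y ∈ A, (φ ^ i) y ∉ A := fun y hy h => h₁ y (hAV hy).1.1.1 (hAV h).1.1.1
  have hAj : ∀ y ∈ A, (φ ^ j) y ∉ A := fun y hy h => h₂ y (hAV hy).1.1.2 (hAV h).1.1.2
  have hAji : ∀ y ∈ A, (φ ^ (-i)) ((φ ^ j) y) ∉ A := fun y hy h => by
    rw [← zpow_add_apply, neg_add_eq_sub] at h
    exact h₃ y (hAV hy).1.2 (hAV h).1.2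
  have hAij : ∀ y ∈ A, (φ ^ (-j)) ((φ ^ i) y) ∉ A := fun y hy h => by
    refine h₃ _ (hAV h).1.2 ?_
    rw [← zpow_add_apply, ← zpow_add_apply, show j - i + -j + i = 0 by ring]
    simpa using (hAV hy).1.2
  obtain ⟨s, hs, hss, s1, s2, s3⟩ := exists_swap φ hA hAi
  obtain ⟨t, ht, htt, t1, t2, t3⟩ := exists_swap φ hA hAj
  have hc : ∀ y, ⁅s, t⁆ y = s (t (s (t y))) := fun y => by
    rw [commutatorElement_def, inv_eq_of_mul_eq_one_left hss, inv_eq_of_mul_eq_one_left htt]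
    rfl
  refine ⟨⁅s, t⁆, Subgroup.commutator_mem_commutator hs ht, fun y => ?_, ?_, ?_, ?_⟩
  · contrapose!
    intro hy
    have hyA : y ∉ A := fun h => hy (hAV h).2.1.1
    have hs' : s y = y := s3 y hyA fun h => hy <| by
      have := (hAV h).2.1.2
      rwa [mem_preimage, ← zpow_add_apply, add_neg_cancel, zpow_zero] at this
    have ht' : t y = y := t3 y hyA fun h => hy <| by
      have := (hAV h).2.2
      rwa [mem_preimage, ← zpow_add_apply, add_neg_cancel, zpow_zero] at this
    rw [mem_movedSet, not_not, hc, ht', hs', ht', hs']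
  · filter_upwards [hA.isOpen.mem_nhds hxA] with y hy
    rw [hc, t1 y hy, s3 _ (hAj y hy) (hAji y hy), t2 y hy, s1 y hy]
  · rw [hc, t3 _ (hAi x hxA) (hAij x hxA), s2 x hxA, t1 x hxA,
      s3 _ (hAj x hxA) (hAji x hxA)]
  · rw [hc, t2 x hxA, s1 x hxA, t3 _ (hAi x hxA) (hAij x hxA), s2 x hxA]

/-- The local richness of a group of homeomorphisms from which the space can be reconstructed:
elements move clopen sets of points, every point can be moved by an element with arbitrarily small
support, and every nonempty open set supports an element whose order does not divide `12`. -/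
structure IsRich (Γ : Subgroup (X ≃ₜ X)) : Prop where
  isClopen : ∀ g ∈ Γ, IsClopen (movedSet g)
  exists_moving : ∀ U : Set X, IsOpen U → ∀ x ∈ U, ∃ g ∈ Γ, movedSet g ⊆ U ∧ x ∈ movedSet g
  exists_pow_ne : ∀ U : Set X, IsOpen U → U.Nonempty → ∃ g ∈ Γ, movedSet g ⊆ U ∧ g ^ 12 ≠ 1

theorem movedSet_mul_subset (f g : X ≃ₜ X) : movedSet (f * g) ⊆ movedSet f ∪ movedSet g := by
  intro x hx
  by_contra h
  rw [mem_union, not_or] at h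
  refine hx ?_
  rw [Homeomorph.mul_apply, apply_eq_of_notMem_movedSet h.2, apply_eq_of_notMem_movedSet h.1]

theorem IsMinimal.isRich [CompactSpace X] [T2Space X] [TotallyDisconnectedSpace X] [PerfectSpace X]
    {φ : X ≃ₜ X} (hφ : IsMinimal φ) {Γ : Subgroup (X ≃ₜ X)} (hΓ : Γ ≤ topologicalFullGroup φ)
    (hD : ⁅topologicalFullGroup φ, topologicalFullGroup φ⁆ ≤ Γ) : IsRich Γ where
  isClopen g hg := hφ.isFree.isClopen_movedSet (hΓ hg)
  exists_moving U hU x hx := by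
    obtain ⟨i, hi, hix⟩ := hφ.exists_zpow_mem hU ⟨x, hx⟩ x {0}
    obtain ⟨j, hj, hjx⟩ := hφ.exists_zpow_mem hU ⟨x, hx⟩ x {0, i}
    simp only [Finset.mem_insert, Finset.mem_singleton, not_or] at hi hj
    obtain ⟨c, hc, hcU, h1, -⟩ :=
      exists_threeCycle hφ.isFree hU hx hix hjx hi hj.1 (Ne.symm hj.2)
    refine ⟨c, hD hc, hcU, ?_⟩
    rw [mem_movedSet, h1.self_of_nhds]
    exact fun h => hi (hφ.isFree i x h)
  exists_pow_ne U hU hne := by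
    obtain ⟨x, hx⟩ := hne
    obtain ⟨i, hi, hix⟩ := hφ.exists_zpow_mem hU ⟨x, hx⟩ x {0}
    obtain ⟨j, hj, hjx⟩ := hφ.exists_zpow_mem hU ⟨x, hx⟩ x {0, i}
    obtain ⟨k, hk, hkx⟩ := hφ.exists_zpow_mem hU ⟨x, hx⟩ x {0, i, j}
    obtain ⟨l, hl, hlx⟩ := hφ.exists_zpow_mem hU ⟨x, hx⟩ x {0, i, j, k}
    simp only [Finset.mem_insert, Finset.mem_singleton, not_or] at hi hj hk hl
    have hne : ∀ {m n : ℤ}, m ≠ n → (φ ^ m) x ≠ (φ ^ n) x :=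
      fun h h' => h (hφ.isFree.zpow_injective h')
    have hne0 : ∀ {n : ℤ}, n ≠ 0 → x ≠ (φ ^ n) x := fun h h' => h (hφ.isFree _ _ h'.symm)
    -- Two `3`-cycles through `x` with no other point in common compose to a `5`-cycle.
    have hopen : ∀ m n : ℤ, IsOpen (U \ {(φ ^ m) x, (φ ^ n) x}) := fun m n =>
      hU.sdiff (toFinite _).isClosed
    have hmem : ∀ {y : X} {m n : ℤ}, y ∈ U → y ≠ (φ ^ m) x → y ≠ (φ ^ n) x →
        y ∈ U \ {(φ ^ m) x, (φ ^ n) x} := fun h h1 h2 => ⟨h, by simp [h1, h2]⟩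
    obtain ⟨s, hs, hsU, s1, s2, s3⟩ := exists_threeCycle hφ.isFree (hopen k l)
      (hmem hx (hne0 hk.1) (hne0 hl.1)) (hmem hix (hne (Ne.symm hk.2.1)) (hne (Ne.symm hl.2.1)))
      (hmem hjx (hne (Ne.symm hk.2.2)) (hne (Ne.symm hl.2.2.1))) hi hj.1 (Ne.symm hj.2)
    obtain ⟨t, ht, htU, t1, t2, t3⟩ := exists_threeCycle hφ.isFree (hopen i j)
      (hmem hx (hne0 hi) (hne0 hj.1)) (hmem hkx (hne hk.2.1) (hne hk.2.2))
      (hmem hlx (hne hl.2.1) (hne hl.2.2.1)) hk.1 hl.1 (Ne.symm hl.2.2.2)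
    replace s1 := s1.self_of_nhds
    replace t1 := t1.self_of_nhds
    have sk : s ((φ ^ k) x) = (φ ^ k) x :=
      apply_eq_of_notMem_movedSet fun h => (hsU h).2 (by simp)
    have sl : s ((φ ^ l) x) = (φ ^ l) x :=
      apply_eq_of_notMem_movedSet fun h => (hsU h).2 (by simp)
    have ti : t ((φ ^ i) x) = (φ ^ i) x :=
      apply_eq_of_notMem_movedSet fun h => (htU h).2 (by simp)
    have tj : t ((φ ^ j) x) = (φ ^ j) x :=
      apply_eq_of_notMem_movedSet fun h => (htU h).2 (by simp)
    refine ⟨s * t, Γ.mul_mem (hD hs) (hD ht), (movedSet_mul_subset s t).trans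
      (union_subset (hsU.trans sdiff_subset) (htU.trans sdiff_subset)), fun h => ?_⟩
    have h' := DFunLike.congr_fun h x
    simp only [pow_succ, pow_zero, one_mul, Homeomorph.mul_apply, s1, s2, s3, t1, t2, t3, sk, sl,
      ti, tj, Homeomorph.one_apply] at h'
    exact hl.1 (hφ.isFree _ _ h')

end Cycles

/-! ### Reconstruction of the space from a rich group -/

section Algebraic

variable {G H : Type*} [Group G] [Group H]

/-- Rubin's algebraic disjointness. In a rich group of homeomorphisms it lies between
disjointness of the supports of `f` and `g` and disjointness of those of `f` and `g ^ 12`. -/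
def AlgDisjoint (f g : G) : Prop :=
  ∀ h : G, ⁅f, h⁆ ≠ 1 → ∃ f₁ f₂ : G, Commute f₁ g ∧ Commute f₂ g ∧
    Commute ⁅f₁, ⁅f₂, h⁆⁆ g ∧ ⁅f₁, ⁅f₂, h⁆⁆ ≠ 1

theorem AlgDisjoint.map (e : G ≃* H) {f g : G} (h : AlgDisjoint f g) :
    AlgDisjoint (e f) (e g) := by
  intro k hk
  obtain ⟨k, rfl⟩ := e.surjective k
  rw [← map_commutatorElement, Ne, map_eq_one_iff e e.injective] at hk
  obtain ⟨f₁, f₂, h1, h2, h3, h4⟩ := h k hk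
  refine ⟨e f₁, e f₂, h1.map e, h2.map e, ?_, ?_⟩
  · rw [← map_commutatorElement, ← map_commutatorElement]
    exact h3.map e
  · rwa [← map_commutatorElement, ← map_commutatorElement, Ne, map_eq_one_iff e e.injective]

theorem algDisjoint_map_iff (e : G ≃* H) {f g : G} :
    AlgDisjoint (e f) (e g) ↔ AlgDisjoint f g :=
  ⟨fun h => by simpa using h.map e.symm, fun h => h.map e⟩

/-- The algebraic counterpart of `k` being supported in the support of `f`: the element `k`
centralizes the twelfth powers of all elements from which `f` is algebraically disjoint. -/
def AlgSupported (f k : G) : Prop := ∀ g : G, AlgDisjoint f g → Commute k (g ^ 12)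

theorem algSupported_map_iff (e : G ≃* H) {f k : G} :
    AlgSupported (e f) (e k) ↔ AlgSupported f k := by
  refine ⟨fun h g hg => ?_, fun h g hg => ?_⟩
  · have := (h (e g) (hg.map e)).map e.symm
    simpa using this
  · obtain ⟨g, rfl⟩ := e.surjective g
    have := (h g ((algDisjoint_map_iff e).1 hg)).map e
    simpa using this

/-- A commutator identity: `h` may be dropped from `⁅f₁, ⁅f₂, h⁆⁆` when it conjugates `f₂` into
the centralizer of `f₁`. -/
theorem commutatorElement_commutatorElement_of_commute {f₁ f₂ h : G}
    (hc : Commute f₁ (h * f₂ * h⁻¹)) : ⁅f₁, ⁅f₂, h⁆⁆ = ⁅f₁, f₂⁆ := by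
  have h1 : ⁅f₂, h⁆ = f₂ * (h * f₂ * h⁻¹)⁻¹ := by rw [commutatorElement_def]; group
  have h2 : f₁⁻¹ * (h * f₂ * h⁻¹) = (h * f₂ * h⁻¹) * f₁⁻¹ := hc.inv_left.eq
  rw [h1]
  generalize h * f₂ * h⁻¹ = k at h2
  calc ⁅f₁, f₂ * k⁻¹⁆ = f₁ * f₂ * k⁻¹ * (f₁⁻¹ * k) * f₂⁻¹ := by
        rw [commutatorElement_def]; group
    _ = ⁅f₁, f₂⁆ := by rw [h2, commutatorElement_def]; group

end Algebraic

section Supports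

variable {X : Type*} [TopologicalSpace X]

theorem apply_mem_movedSet {f : X ≃ₜ X} {x : X} (hx : x ∈ movedSet f) : f x ∈ movedSet f :=
  fun h => hx (f.injective h)

theorem movedSet_inv (f : X ≃ₜ X) : movedSet f⁻¹ = movedSet f := by
  ext x
  rw [mem_movedSet, mem_movedSet, Homeomorph.inv_apply, Ne, Homeomorph.symm_apply_eq, eq_comm]

theorem mem_movedSet_conj {f h : X ≃ₜ X} {x : X} :
    x ∈ movedSet (h * f * h⁻¹) ↔ h⁻¹ x ∈ movedSet f := by
  rw [mem_movedSet, mem_movedSet, not_iff_not]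
  exact h.eq_symm_apply.symm

theorem commute_of_disjoint_movedSet {f g : X ≃ₜ X} (h : Disjoint (movedSet f) (movedSet g)) :
    Commute f g := by
  refine Homeomorph.ext fun x => ?_
  change f (g x) = g (f x)
  by_cases hf : x ∈ movedSet f
  · rw [apply_eq_of_notMem_movedSet (disjoint_left.1 h hf),
      apply_eq_of_notMem_movedSet (disjoint_left.1 h (apply_mem_movedSet hf))]
  · rw [apply_eq_of_notMem_movedSet hf]
    by_cases hg : x ∈ movedSet g
    · exact apply_eq_of_notMem_movedSet (disjoint_right.1 h (apply_mem_movedSet hg))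
    · rw [apply_eq_of_notMem_movedSet hg, apply_eq_of_notMem_movedSet hf]

theorem apply_mem_movedSet_iff_of_commute {f g : X ≃ₜ X} (h : Commute f g) {x : X} :
    g x ∈ movedSet f ↔ x ∈ movedSet f := by
  rw [mem_movedSet, mem_movedSet, not_iff_not, ← Homeomorph.mul_apply, h.eq,
    Homeomorph.mul_apply, g.injective.eq_iff]

/-- An element supported in a set which `h` maps off itself does not commute with `h`. -/
theorem not_commute_of_disjoint_image {h g : X ≃ₜ X} {V : Set X} {x : X} (hV : ∀ y ∈ V, h y ∉ V)
    (hg : movedSet g ⊆ V) (hx : x ∈ movedSet g) : ¬ Commute h g := fun hc =>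
  hV x (hg hx) (hg ((apply_mem_movedSet_iff_of_commute hc.symm).2 hx))

theorem movedSet_commutatorElement_subset {f h : X ≃ₜ X} {x : X} (hx : x ∈ movedSet ⁅f, h⁆) :
    f⁻¹ x ∈ movedSet h ∨ x ∈ movedSet h := by
  rw [commutatorElement_def] at hx
  rcases movedSet_mul_subset _ _ hx with hx | hx
  · exact Or.inl (mem_movedSet_conj.1 hx)
  · exact Or.inr (movedSet_inv h ▸ hx)

theorem exists_mem_movedSet {f : X ≃ₜ X} (hf : f ≠ 1) : ∃ x, x ∈ movedSet f := by
  by_contra! h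
  exact hf (Homeomorph.ext fun x => apply_eq_of_notMem_movedSet (h x))

variable {Γ : Subgroup (X ≃ₜ X)}

theorem IsRich.exists_not_commute [T2Space X] (hΓ : IsRich Γ) {U : Set X} (hU : IsOpen U) {x : X}
    (hx : x ∈ U) : ∃ a b : Γ, movedSet a.1 ⊆ U ∧ movedSet b.1 ⊆ U ∧ ¬ Commute a.1 b.1 := by
  obtain ⟨a, ha, haU, hax⟩ := hΓ.exists_moving U hU x hx
  obtain ⟨V, hV, hxV, hd⟩ := exists_isOpen_disjoint_image hax
  obtain ⟨b, hb, hbU, hbx⟩ := hΓ.exists_moving (U ∩ V) (hU.inter hV) x ⟨hx, hxV⟩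
  exact ⟨⟨a, ha⟩, ⟨b, hb⟩, haU, hbU.trans inter_subset_left,
    not_commute_of_disjoint_image hd (hbU.trans inter_subset_right) hbx⟩

theorem coe_commute_iff {a b : Γ} : Commute a.1 b.1 ↔ Commute a b :=
  (Subtype.ext_iff (a1 := a * b) (a2 := b * a)).symm

theorem IsRich.algDisjoint_of_disjoint [T2Space X] (hΓ : IsRich Γ) {f g : Γ}
    (hfg : Disjoint (movedSet f.1) (movedSet g.1)) : AlgDisjoint f g := by
  intro h hfh
  obtain ⟨x, hxf, hxh⟩ : ∃ x, x ∈ movedSet f.1 ∧ x ∈ movedSet h.1 := by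
    refine not_disjoint_iff.1 fun hd => hfh ?_
    exact commutatorElement_eq_one_iff_commute.2
      (coe_commute_iff.1 (commute_of_disjoint_movedSet hd))
  obtain ⟨V, hV, hxV, hVd⟩ := exists_isOpen_disjoint_image hxh
  obtain ⟨a, b, ha, hb, hab⟩ := hΓ.exists_not_commute
    (hV.inter (hΓ.isClopen f f.2).isOpen) ⟨hxV, hxf⟩
  have hcomm : ∀ c : Γ, movedSet c.1 ⊆ V ∩ movedSet f.1 → Commute c g := fun c hc =>
    coe_commute_iff.1 (commute_of_disjoint_movedSet (hfg.mono_left (hc.trans inter_subset_right)))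
  have hconj : Commute a (h * b * h⁻¹) := by
    refine coe_commute_iff.1 (commute_of_disjoint_movedSet (disjoint_left.2 fun y hy hy' => ?_))
    have h1 : h.1⁻¹ y ∈ V := (hb (mem_movedSet_conj.1 hy')).1
    refine hVd _ h1 ?_
    rw [← Homeomorph.mul_apply, mul_inv_cancel]
    exact (ha hy).1
  have key := commutatorElement_commutatorElement_of_commute hconj
  refine ⟨a, b, hcomm a ha, hcomm b hb, ?_, ?_⟩
  · rw [key, commutatorElement_def]
    exact (((hcomm a ha).mul_left (hcomm b hb)).mul_left (hcomm a ha).inv_left).mul_left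
      (hcomm b hb).inv_left
  · rw [key, Ne, commutatorElement_eq_one_iff_commute]
    exact fun h' => hab (coe_commute_iff.2 h')

/-- If `g` has orbits of length at least five in the support of `f`, the defining property of
algebraic disjointness fails for small `h`: the commutator `⁅f₁, ⁅f₂, h⁆⁆` is supported in four
translates of the support of `h`, too few for its support to be invariant under `g`. -/
theorem IsRich.disjoint_of_algDisjoint [T2Space X] (hΓ : IsRich Γ) {f g : Γ}
    (hfg : AlgDisjoint f g) : Disjoint (movedSet f.1) (movedSet (g.1 ^ 12)) := by
  refine disjoint_left.2 fun x hxf hxg => ?_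
  -- Every `m ∈ {1, 2, 3, 4}` divides `12`.
  have hgm : ∀ m : Fin 4, (g.1 ^ (m.1 + 1)) x ≠ x := fun m h => hxg <| by
    have hdvd : m.1 + 1 ∣ 12 := by fin_cases m <;> decide
    obtain ⟨q, hq⟩ := hdvd
    rw [hq, pow_mul]
    simpa using zpow_apply_of_apply_eq h (q : ℤ)
  choose V hVo hxV hV using fun m => exists_isOpen_disjoint_image (hgm m)
  obtain ⟨W, hWo, hxW, hW⟩ := exists_isOpen_disjoint_image hxf
  obtain ⟨h, hh, hhU, hxh⟩ := hΓ.exists_moving (W ∩ ⋂ m, V m)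
    (hWo.inter (isOpen_iInter_of_finite hVo)) x ⟨hxW, mem_iInter.2 hxV⟩
  obtain ⟨f₁, f₂, h1, h2, h3, h4⟩ := hfg ⟨h, hh⟩ fun hc =>
    not_commute_of_disjoint_image hW (hhU.trans inter_subset_left) hxh
      (coe_commute_iff.2 (commutatorElement_eq_one_iff_commute.1 hc))
  rw [← coe_commute_iff] at h1 h2 h3
  obtain ⟨w, hw⟩ := exists_mem_movedSet fun h' => h4 (Subtype.ext h')
  let c : Fin 4 → (X ≃ₜ X) := ![1, f₁.1, f₂.1, f₁.1 * f₂.1]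
  have hc : ∀ l, Commute (c l) g.1 := fun l => by
    fin_cases l
    exacts [Commute.one_left _, h1, h2, h1.mul_left h2]
  have hsupp : ∀ j : Fin 5, ∃ l, (c l)⁻¹ ((g.1 ^ j.1) w) ∈ movedSet h := fun j => by
    have hj := (apply_mem_movedSet_iff_of_commute (h3.pow_right j.1)).2 hw
    generalize (g.1 ^ j.1) w = z at hj
    rcases movedSet_commutatorElement_subset hj with hj | hj <;>
      rcases movedSet_commutatorElement_subset hj with hj | hj
    · refine ⟨3, ?_⟩
      change (f₁.1 * f₂.1)⁻¹ z ∈ _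
      rwa [mul_inv_rev]
    exacts [⟨1, hj⟩, ⟨2, hj⟩, ⟨0, hj⟩]
  choose l hl using hsupp
  obtain ⟨i, j, hij, hlij⟩ := Fintype.exists_ne_map_eq_of_card_lt l (by simp)
  have key : ∀ i j : Fin 5, i < j → l i = l j → False := fun i j hlt heq => by
    have hi := (hhU (hl i)).2
    have hj := (hhU (hl j)).2
    have hlt' : i.1 < j.1 := hlt
    have hjlt := j.2
    let m : Fin 4 := ⟨j.1 - i.1 - 1, by omega⟩
    refine hV m _ (mem_iInter.1 hi m) ?_
    have hm : j.1 = m.1 + 1 + i.1 := by simp only [m]; omega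
    have hcm : Commute (c (l i))⁻¹ (g.1 ^ (m.1 + 1)) := (hc _).inv_left.pow_right _
    have heq' : (c (l j))⁻¹ ((g.1 ^ j.1) w) = (g.1 ^ (m.1 + 1)) ((c (l i))⁻¹ ((g.1 ^ i.1) w)) := by
      rw [← heq, hm, pow_add, Homeomorph.mul_apply, ← Homeomorph.mul_apply (c (l i))⁻¹, hcm.eq]
      rfl
    rw [← heq']
    exact mem_iInter.1 hj m
  rcases lt_or_gt_of_ne hij with h | h
  exacts [key i j h hlij, key j i h hlij.symm]

theorem IsRich.algSupported_iff [T2Space X] (hΓ : IsRich Γ) {f k : Γ} :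
    AlgSupported f k ↔ movedSet k.1 ⊆ movedSet f.1 := by
  refine ⟨fun h y hy => ?_, fun h g hg => ?_⟩
  · by_contra hyf
    obtain ⟨V, hVo, hyV, hV⟩ := exists_isOpen_disjoint_image hy
    obtain ⟨g, hg, hgV, hg12⟩ := hΓ.exists_pow_ne (V ∩ (movedSet f.1)ᶜ)
      (hVo.inter (hΓ.isClopen f f.2).compl.isOpen) ⟨y, hyV, hyf⟩
    have hc := h ⟨g, hg⟩ (hΓ.algDisjoint_of_disjoint
      (disjoint_left.2 fun z hz hz' => (hgV hz').2 hz))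
    obtain ⟨z, hz⟩ := exists_mem_movedSet hg12
    have hsub : movedSet (g ^ 12) ⊆ movedSet g := fun z hz hz' =>
      hz (by simpa using zpow_apply_of_apply_eq hz' 12)
    exact not_commute_of_disjoint_image hV ((hsub.trans hgV).trans inter_subset_left) hz
      (coe_commute_iff.2 hc)
  · exact coe_commute_iff.1 (commute_of_disjoint_movedSet
      ((hΓ.disjoint_of_algDisjoint hg).mono_left h))

end Supports

section Reconstruction

variable {X Y : Type*} [TopologicalSpace X] [TopologicalSpace Y]
  {Γ : Subgroup (X ≃ₜ X)} {Δ : Subgroup (Y ≃ₜ Y)}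

theorem IsRich.movedSet_subset_iff [T2Space X] [T2Space Y] (hΓ : IsRich Γ) (hΔ : IsRich Δ)
    (α : Γ ≃* Δ) {f g : Γ} :
    movedSet (α f).1 ⊆ movedSet (α g).1 ↔ movedSet f.1 ⊆ movedSet g.1 := by
  rw [← hΔ.algSupported_iff, algSupported_map_iff, hΓ.algSupported_iff]

/-- The points `x` and `y` correspond to each other under the group isomorphism `α`: an element
moves `x` if and only if its image moves `y`. -/
def Corresponds (α : Γ ≃* Δ) (x : X) (y : Y) : Prop :=
  ∀ g : Γ, x ∈ movedSet g.1 ↔ y ∈ movedSet (α g).1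

theorem Corresponds.symm {α : Γ ≃* Δ} {x : X} {y : Y} (h : Corresponds α x y) :
    Corresponds α.symm y x := fun g => by
  have := h (α.symm g)
  rw [α.apply_symm_apply] at this
  exact this.symm

theorem IsRich.eq_of_corresponds [T2Space Y] (hΔ : IsRich Δ) {α : Γ ≃* Δ} {x : X} {y z : Y}
    (hy : Corresponds α x y) (hz : Corresponds α x z) : y = z := by
  by_contra hne
  obtain ⟨g, hg, hgz, hgy⟩ := hΔ.exists_moving {z}ᶜ isOpen_compl_singleton y hne
  obtain ⟨g', hg'⟩ := α.surjective ⟨g, hg⟩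
  have h1 := (hz g').1 ((hy g').2 (by rwa [hg']))
  rw [hg'] at h1
  exact hgz h1 rfl

/-- The corresponding point is found by compactness in the intersection of the supports of all
`α g` with `g` moving `x`. -/
theorem IsRich.exists_corresponds [T2Space X] [T2Space Y] [CompactSpace Y] (hΓ : IsRich Γ)
    (hΔ : IsRich Δ) (α : Γ ≃* Δ) (x : X) : ∃ y, Corresponds α x y := by
  have hsmall : ∀ U : Set X, IsOpen U → x ∈ U → ∃ h : Γ, movedSet h.1 ⊆ U ∧ x ∈ movedSet h.1 :=
    fun U hU hx => by
      obtain ⟨h, hh, h1, h2⟩ := hΓ.exists_moving U hU x hx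
      exact ⟨⟨h, hh⟩, h1, h2⟩
  let ι := {g : Γ // x ∈ movedSet g.1}
  obtain ⟨g₀, -, hg₀⟩ := hsmall univ isOpen_univ (mem_univ x)
  have : Nonempty ι := ⟨⟨g₀, hg₀⟩⟩
  have hmeet : ∀ g h : Γ, x ∈ movedSet g.1 → x ∈ movedSet h.1 → ∃ k : ι,
      movedSet (α k.1).1 ⊆ movedSet (α g).1 ∧ movedSet (α k.1).1 ⊆ movedSet (α h).1 :=
    fun g h hg hh => by
      obtain ⟨k, hk, hxk⟩ := hsmall (movedSet g.1 ∩ movedSet h.1)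
        ((hΓ.isClopen g g.2).isOpen.inter (hΓ.isClopen h h.2).isOpen) ⟨hg, hh⟩
      exact ⟨⟨k, hxk⟩, (hΓ.movedSet_subset_iff hΔ α).2 (hk.trans inter_subset_left),
        (hΓ.movedSet_subset_iff hΔ α).2 (hk.trans inter_subset_right)⟩
  have hclosed : ∀ g : ι, IsClosed (movedSet (α g.1).1) := fun g =>
    (hΔ.isClopen _ (α g.1).2).isClosed
  have hne : ∀ g : Γ, x ∈ movedSet g.1 → (movedSet (α g).1).Nonempty := fun g hg => by
    refine exists_mem_movedSet fun h => hg ?_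
    have : α g = 1 := Subtype.ext h
    rw [map_eq_one_iff α α.injective] at this
    rw [this]; rfl
  obtain ⟨y, hy⟩ := IsCompact.nonempty_iInter_of_directed_nonempty_isCompact_isClosed
    (fun g : ι => movedSet (α g.1).1) (fun g h => hmeet g.1 h.1 g.2 h.2)
    (fun g => hne g.1 g.2) (fun g => (hclosed g).isCompact) hclosed
  rw [mem_iInter] at hy
  refine ⟨y, fun g => ⟨fun hg => hy ⟨g, hg⟩, fun hg => ?_⟩⟩
  -- If `g` fixes `x`, some `h` moving `x` has support disjoint from that of `g`; then the supports
  -- of `α g` and `α h` are disjoint as well, although both contain `y`.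
  by_contra hxg
  obtain ⟨h, hh, hxh⟩ := hsmall (movedSet g.1)ᶜ (hΓ.isClopen g g.2).compl.isOpen hxg
  obtain ⟨k, hk, hk', hyk⟩ := hΔ.exists_moving (movedSet (α g).1 ∩ movedSet (α h).1)
    ((hΔ.isClopen _ (α g).2).isOpen.inter (hΔ.isClopen _ (α h).2).isOpen) y ⟨hg, hy ⟨h, hxh⟩⟩
  obtain ⟨k', hk''⟩ := α.surjective ⟨k, hk⟩
  have hα : movedSet (α k').1 ⊆ movedSet (α g).1 ∩ movedSet (α h).1 := by rwa [hk'']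
  have h1 := (hΓ.movedSet_subset_iff hΔ α).1 (hα.trans inter_subset_left)
  have h2 := (hΓ.movedSet_subset_iff hΔ α).1 (hα.trans inter_subset_right)
  have h3 : k' = 1 := by
    by_contra hne
    obtain ⟨z, hz⟩ := exists_mem_movedSet fun h' => hne (Subtype.ext h')
    exact hh (h2 hz) (h1 hz)
  rw [h3, map_one] at hk''
  rw [← show (1 : Y ≃ₜ Y) = k from congrArg Subtype.val hk''] at hyk
  exact hyk rfl

theorem IsRich.continuous_of_corresponds (hΓ : IsRich Γ) (hΔ : IsRich Δ) {α : Γ ≃* Δ}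
    {F : X → Y} (hF : ∀ x, Corresponds α x (F x)) : Continuous F := by
  refine continuous_iff_continuousAt.2 fun x V hV => ?_
  obtain ⟨U, hUV, hU, hxU⟩ := mem_nhds_iff.1 hV
  obtain ⟨g, hg, hgU, hgx⟩ := hΔ.exists_moving U hU (F x) hxU
  obtain ⟨g', hg'⟩ := α.surjective ⟨g, hg⟩
  have hmem : ∀ z, z ∈ movedSet g'.1 ↔ F z ∈ movedSet g := fun z => by rw [hF z g', hg']
  change ∀ᶠ z in 𝓝 x, F z ∈ V
  filter_upwards [(hΓ.isClopen g' g'.2).isOpen.mem_nhds ((hmem x).2 hgx)] with z hz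
  exact hUV (hgU ((hmem z).1 hz))

/-- Every isomorphism between rich groups of homeomorphisms of compact spaces is spatial. -/
theorem IsRich.exists_homeomorph [T2Space X] [T2Space Y] [CompactSpace X] [CompactSpace Y]
    (hΓ : IsRich Γ) (hΔ : IsRich Δ) (α : Γ ≃* Δ) :
    ∃ F : X ≃ₜ Y, ∀ (g : Γ) (x : X), F (g.1 x) = (α g).1 (F x) := by
  choose F hF using hΓ.exists_corresponds hΔ α
  choose F' hF' using hΔ.exists_corresponds hΓ α.symm
  let e : X ≃ₜ Y :=
    { toFun := F
      invFun := F'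
      left_inv := fun x => hΓ.eq_of_corresponds (hF' (F x)) (hF x).symm
      right_inv := fun y => hΔ.eq_of_corresponds (hF (F' y)) (hF' y).symm
      continuous_toFun := hΓ.continuous_of_corresponds hΔ hF
      continuous_invFun := hΔ.continuous_of_corresponds hΓ hF' }
  refine ⟨e, fun g x => hΔ.eq_of_corresponds (hF (g.1 x)) fun k => ?_⟩
  have h1 : g.1 x ∈ movedSet k.1 ↔ x ∈ movedSet (g⁻¹ * k * g⁻¹⁻¹ : Γ).1 := by
    have := mem_movedSet_conj (f := k.1) (h := g.1⁻¹) (x := x)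
    rw [inv_inv] at this
    exact this.symm
  have h2 : (α g).1 (e x) ∈ movedSet (α k).1 ↔ e x ∈ movedSet (α (g⁻¹ * k * g⁻¹⁻¹)).1 := by
    have := mem_movedSet_conj (f := (α k).1) (h := (α g).1⁻¹) (x := e x)
    rw [inv_inv] at this
    rw [map_mul, map_mul, inv_inv, map_inv]
    exact this.symm
  rw [h1, h2]
  exact hF x _

end Reconstruction

/-! ### The net flow of a map of the integers across the origin -/

section Net

open Filter

/-- The indicator function of the nonnegative integers. -/
def nonnegInd (m : ℤ) : ℤ := if 0 ≤ m then 1 else 0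

/-- The number of `k ≥ 0` with `a k < 0` minus the number of `k < 0` with `a k ≥ 0`. This is
meaningful when both numbers are finite, for instance if `a` tends to `±∞` at `±∞`. -/
noncomputable def netFlow (a : ℤ → ℤ) : ℤ := ∑ᶠ k, (nonnegInd k - nonnegInd (a k))

theorem finite_support_nonnegInd_sub {a : ℤ → ℤ} (ht : Tendsto a atTop atTop)
    (hb : Tendsto a atBot atBot) {b : ℤ → ℤ} (ht' : Tendsto b atTop atTop)
    (hb' : Tendsto b atBot atBot) :
    (Function.support fun k => nonnegInd (a k) - nonnegInd (b k)).Finite := by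
  have h : ∀ᶠ k in cofinite, nonnegInd (a k) - nonnegInd (b k) = 0 := by
    rw [Int.cofinite_eq, eventually_sup]
    constructor
    · filter_upwards [hb.eventually_lt_atBot 0, hb'.eventually_lt_atBot 0] with k h1 h2
      simp [nonnegInd, h1.not_ge, h2.not_ge]
    · filter_upwards [ht.eventually_ge_atTop 0, ht'.eventually_ge_atTop 0] with k h1 h2
      simp [nonnegInd, h1, h2]
  exact h

theorem nonnegInd_sub_one (m : ℤ) : nonnegInd (m - 1) = nonnegInd m - if m = 0 then 1 else 0 := by
  unfold nonnegInd
  split_ifs <;> omega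

theorem netFlow_eq_sum {a : ℤ → ℤ} {M : ℤ} (h1 : ∀ k, M ≤ k → 0 ≤ a k)
    (h2 : ∀ k, k ≤ -M → a k < 0) :
    netFlow a = ∑ k ∈ Finset.Icc (-|M|) |M|, (nonnegInd k - nonnegInd (a k)) := by
  refine finsum_eq_sum_of_support_subset _ fun k hk => ?_
  by_contra hk'
  refine hk ?_
  have hM := abs_nonneg M
  have hM' := le_abs_self M
  rw [Finset.coe_Icc, mem_Icc, not_and_or, not_le, not_le] at hk'
  rcases hk' with h | h
  · have := h2 k (by omega)
    simp [nonnegInd, this.not_ge, show ¬ 0 ≤ k by omega]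
  · have := h1 k (by omega)
    simp [nonnegInd, this, show 0 ≤ k by omega]

variable {a : ℤ → ℤ}

theorem netFlow_comp_add_one (ht : Tendsto a atTop atTop) (hb : Tendsto a atBot atBot) :
    netFlow (fun k => a (k + 1)) = netFlow a - 1 := by
  have hshift : netFlow (fun k => a (k + 1)) = ∑ᶠ k, (nonnegInd (k - 1) - nonnegInd (a k)) := by
    rw [netFlow, ← finsum_comp_equiv (Equiv.addRight (1 : ℤ))
      (f := fun k => nonnegInd (k - 1) - nonnegInd (a k))]
    simp
  have hpt : ∀ k, nonnegInd (k - 1) - nonnegInd (a k) =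
      (nonnegInd k - nonnegInd (a k)) - if k = 0 then 1 else 0 := fun k => by
    rw [nonnegInd_sub_one]; ring
  rw [hshift, finsum_congr hpt,
    finsum_sub_distrib (finite_support_nonnegInd_sub (a := fun k => k) tendsto_id tendsto_id ht hb)
      ((finite_singleton (0 : ℤ)).subset fun k hk => by simpa using hk),
    finsum_eq_single (fun k : ℤ => if k = 0 then (1 : ℤ) else 0) 0 fun k hk => if_neg hk]
  simp [netFlow]

theorem netFlow_sub_one (ht : Tendsto a atTop atTop) (hb : Tendsto a atBot atBot)
    (ha : Function.Bijective a) : netFlow (fun k => a k - 1) = netFlow a + 1 := by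
  have hpt : ∀ k, nonnegInd k - nonnegInd (a k - 1) =
      (nonnegInd k - nonnegInd (a k)) + if a k = 0 then 1 else 0 := fun k => by
    rw [nonnegInd_sub_one]; ring
  obtain ⟨k₀, hk₀⟩ := ha.2 0
  have huniq : ∀ k, k ≠ k₀ → a k ≠ 0 := fun k hk h => hk (ha.1 (h.trans hk₀.symm))
  rw [netFlow, finsum_congr hpt,
    finsum_add_distrib (finite_support_nonnegInd_sub (a := fun k => k) tendsto_id tendsto_id ht hb)
      ((finite_singleton k₀).subset fun k hk => by
        by_contra h
        exact hk (if_neg (huniq k h))),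
    finsum_eq_single (fun k => if a k = 0 then (1 : ℤ) else 0) k₀ fun k hk => if_neg (huniq k hk)]
  simp [netFlow, hk₀]

theorem netFlow_sub (ht : Tendsto a atTop atTop) (hb : Tendsto a atBot atBot)
    (ha : Function.Bijective a) (m : ℤ) : netFlow (fun k => a k - m) = netFlow a + m := by
  have ht' : ∀ m : ℤ, Tendsto (fun k => a k - m) atTop atTop := fun m =>
    tendsto_atTop_add_const_right _ (-m) ht
  have hb' : ∀ m : ℤ, Tendsto (fun k => a k - m) atBot atBot := fun m =>
    tendsto_atBot_add_const_right _ (-m) hb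
  have ha' : ∀ m : ℤ, Function.Bijective (fun k => a k - m) := fun m =>
    (Equiv.subRight m).bijective.comp ha
  induction m with
  | zero => simp
  | succ m ih =>
    have := netFlow_sub_one (ht' m) (hb' m) (ha' m)
    simp only [sub_sub] at this ih
    rw [this, ih]; ring
  | pred m ih =>
    have := netFlow_sub_one (ht' (-m - 1)) (hb' (-m - 1)) (ha' (-m - 1))
    simp only [sub_sub (a _)] at this
    rw [show (-(m : ℤ) - 1 + 1) = -m by ring, ih] at this
    linarith

/-- Moving both the source and the target origin changes the net flow by the difference. -/
theorem netFlow_shift (ht : Tendsto a atTop atTop) (hb : Tendsto a atBot atBot)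
    (ha : Function.Bijective a) (m : ℤ) :
    netFlow (fun k => a (k + 1) - m) = netFlow a - 1 + m := by
  rw [netFlow_sub (a := fun k => a (k + 1)) (ht.comp (tendsto_atTop_add_const_right _ 1 tendsto_id))
    (hb.comp (tendsto_atBot_add_const_right _ 1 tendsto_id))
    (ha.comp (Equiv.addRight (1 : ℤ)).bijective), netFlow_comp_add_one ht hb]

/-- The values of `a` cannot jump across the interval `[-C, C]` in steps of size at most `C`. -/
theorem pos_or_neg_of_bounded_increments {C M : ℤ} (hC : ∀ k, |a (k + 1) - a k| ≤ C)
    (hbig : ∀ k, M ≤ k → C < |a k|) : (∀ k, M ≤ k → 0 < a k) ∨ ∀ k, M ≤ k → a k < 0 := by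
  have hC0 : 0 ≤ C := (abs_nonneg _).trans (hC 0)
  have hstep : ∀ k, M ≤ k → (0 < a (k + 1) ↔ 0 < a k) := fun k hk => by
    have h1 := hbig (k + 1) (by omega)
    have h2 := hbig k hk
    have h3 := abs_le.1 (hC k)
    rw [lt_abs] at h1 h2
    omega
  have hall : ∀ k, M ≤ k → (0 < a k ↔ 0 < a M) := fun k hk => by
    induction k, hk using Int.leInduction with
    | base => rfl
    | succ k hk ih => rw [hstep k hk, ih]
  rcases lt_or_ge 0 (a M) with h | h
  · exact Or.inl fun k hk => (hall k hk).2 h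
  · refine Or.inr fun k hk => ?_
    have h1 := mt (hall k hk).1 h.not_gt
    have h2 := hbig k hk
    rw [lt_abs] at h2
    omega

/-- A bijection `a` of the integers with bounded increments, whose inverse satisfies a linear bound,
preserves or reverses the two ends of `ℤ`. -/
theorem ends_of_bounded_increments {C C' : ℤ} (ha : Function.Bijective a)
    (hC : ∀ k, |a (k + 1) - a k| ≤ C) (hC' : ∀ k, |k| ≤ C' * |a k|) :
    ((∀ k, C' * C + 1 ≤ k → 0 < a k) ∧ ∀ k, k ≤ -(C' * C + 1) → a k < 0) ∨
      ((∀ k, C' * C + 1 ≤ k → a k < 0) ∧ ∀ k, k ≤ -(C' * C + 1) → 0 < a k) := by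
  have hC0 : 0 ≤ C := (abs_nonneg _).trans (hC 0)
  have hC'0 : 0 < C' := by
    by_contra! h
    have h1 := hC' 1
    have h2 : C' * |a 1| ≤ 0 := mul_nonpos_of_nonpos_of_nonneg h (abs_nonneg _)
    simp at h1
    omega
  have hbig : ∀ k, C' * C + 1 ≤ |k| → C < |a k| := fun k hk => by
    have : C' * C < C' * |a k| := by have := hC' k; omega
    exact lt_of_mul_lt_mul_left this hC'0.le
  generalize C' * C + 1 = M at *
  have hup := pos_or_neg_of_bounded_increments (a := a) (M := M) hC
    fun k hk => hbig k (hk.trans (le_abs_self k))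
  have hdown : (∀ k, k ≤ -M → 0 < a k) ∨ ∀ k, k ≤ -M → a k < 0 := by
    refine (pos_or_neg_of_bounded_increments (a := fun k => a (-k)) (C := C) (M := M)
      (fun k => ?_) fun k hk => hbig (-k) (by rw [abs_neg]; exact hk.trans (le_abs_self k))).imp
      (fun h k hk => ?_) fun h k hk => ?_
    · have := hC (-(k + 1))
      rwa [neg_add, neg_add_cancel_right, ← neg_add, abs_sub_comm] at this
    all_goals simpa using h (-k) (by omega)
  have hinf : ∀ S : Set ℤ, S.Infinite → ¬ a ⁻¹' S ⊆ Ioo (-M) M := fun S hS h =>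
    hS (((finite_Ioo (-M) M).subset h).of_preimage ha.2)
  rcases hup with hu | hu <;> rcases hdown with hd | hd
  · refine absurd (fun k hk => ?_) (hinf (Iic 0) (Set.Iic_infinite 0))
    by_contra h
    rw [mem_Ioo, not_and_or, not_lt, not_lt] at h
    exact h.elim (fun h => (hd k h).not_ge hk) fun h => (hu k h).not_ge hk
  · exact Or.inl ⟨hu, hd⟩
  · exact Or.inr ⟨hu, hd⟩
  · refine absurd (fun k hk => ?_) (hinf (Ici 0) (Set.Ici_infinite 0))
    by_contra h
    rw [mem_Ioo, not_and_or, not_lt, not_lt] at h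
    exact h.elim (fun h => (hd k h).not_ge hk) fun h => (hu k h).not_ge hk

/-- The bound `hC'` says that `a` is proper. -/
theorem tendsto_of_linear_bound {C' M : ℤ} (hC' : ∀ k, |k| ≤ C' * |a k|)
    (h1 : ∀ k, M ≤ k → 0 < a k) (h2 : ∀ k, k ≤ -M → a k < 0) :
    Tendsto a atTop atTop ∧ Tendsto a atBot atBot := by
  have hC'0 : 0 < C' := by
    by_contra! h
    have h1 := hC' 1
    have h2 : C' * |a 1| ≤ 0 := mul_nonpos_of_nonpos_of_nonneg h (abs_nonneg _)
    simp at h1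
    omega
  constructor
  · refine tendsto_atTop.2 fun B => ?_
    filter_upwards [eventually_ge_atTop M, eventually_ge_atTop (C' * B)] with k hk hk'
    have h3 := hC' k
    rw [abs_of_pos (h1 k hk)] at h3
    exact le_of_mul_le_mul_left (hk'.trans ((le_abs_self k).trans h3)) hC'0
  · refine tendsto_atBot.2 fun B => ?_
    filter_upwards [eventually_le_atBot (-M), eventually_le_atBot (C' * B)] with k hk hk'
    have h3 := hC' k
    rw [abs_of_neg (h2 k hk), mul_neg] at h3
    exact le_of_mul_le_mul_left (by have := neg_le_abs k; omega) hC'0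

end Net

/-! ### Boyle's theorem on bounded orbit equivalence -/

section Boyle

open Filter

variable {X : Type*} [TopologicalSpace X]

theorem continuous_netFlow {a : X → ℤ → ℤ} (hac : ∀ k, Continuous fun x => a x k) {M : ℤ}
    (h1 : ∀ x k, M ≤ k → 0 ≤ a x k) (h2 : ∀ x k, k ≤ -M → a x k < 0) :
    Continuous fun x => netFlow (a x) := by
  simp only [fun x => netFlow_eq_sum (h1 x) (h2 x)]
  exact continuous_finsetSum _ fun k _ =>
    continuous_const.sub ((continuous_of_discreteTopology (f := nonnegInd)).comp (hac k))

theorem exists_int_bound [CompactSpace X] {n : X → ℤ} (hn : Continuous n) :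
    ∃ C : ℤ, ∀ x, |n x| ≤ C := by
  obtain ⟨C, hC⟩ := (isCompact_range (hn.abs)).bddAbove
  exact ⟨C, fun x => hC ⟨x, rfl⟩⟩

theorem IsMinimal.eq_empty_or_univ {φ : X ≃ₜ X} (hφ : IsMinimal φ) {P : Set X} (hP : IsClopen P)
    (hinv : ∀ x, φ x ∈ P ↔ x ∈ P) : P = ∅ ∨ P = univ := by
  by_contra! h
  obtain ⟨⟨x, hx⟩, hne⟩ := h
  obtain ⟨y, hy⟩ := (ne_univ_iff_exists_notMem P).1 hne
  obtain ⟨z, hz, k, rfl⟩ := (hφ y).inter_open_nonempty P hP.isOpen ⟨x, hx⟩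
  have hk : ∀ k : ℤ, (φ ^ k) y ∉ P := fun k => by
    induction k with
    | zero => simpa using hy
    | succ k ih => rwa [add_comm, zpow_add_apply, zpow_one, hinv]
    | pred k ih =>
      rwa [← hinv, apply_zpow_apply, add_sub_cancel]
  exact hk k hz

/-- A continuous invariant integer-valued function is constant. -/
theorem IsMinimal.constant {φ : X ≃ₜ X} (hφ : IsMinimal φ) {n : X → ℤ} (hn : Continuous n)
    (hinv : ∀ x, n (φ x) = n x) (x y : X) : n x = n y := by
  rcases hφ.eq_empty_or_univ (P := n ⁻¹' {n y}) ((isClopen_discrete _).preimage hn)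
    (fun z => by simp [hinv]) with h | h
  · exact absurd (show y ∈ n ⁻¹' {n y} from rfl) (h ▸ notMem_empty y)
  · exact (h ▸ mem_univ x : x ∈ n ⁻¹' {n y})

/-- If `ψ` and `φ` have the same orbits and the `ψ`-order on each orbit agrees with the `φ`-order
near the two ends, then `x ↦ φ ^ (-d x) x` conjugates `ψ` to `φ`, where `d x` is the difference in
size of the forward `ψ`-orbit and the forward `φ`-orbit of `x`. -/
theorem exists_conj_of_oriented [CompactSpace X] [T2Space X] {φ ψ : X ≃ₜ X} (hφ : IsFree φ)
    (hψ : IsFree ψ) {a : X → ℤ → ℤ} (hac : ∀ k, Continuous fun x => a x k)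
    (ha : ∀ x k, (ψ ^ k) x = (φ ^ a x k) x) (hsurj : ∀ x, Function.Surjective (a x))
    (htop : ∀ x, Tendsto (a x) atTop atTop) (hbot : ∀ x, Tendsto (a x) atBot atBot) {M : ℤ}
    (h1 : ∀ x k, M ≤ k → 0 ≤ a x k) (h2 : ∀ x k, k ≤ -M → a x k < 0) :
    ∃ h : X ≃ₜ X, ∀ x, h (ψ x) = φ (h x) := by
  have hshift : ∀ x k, a (ψ x) k = a x (k + 1) - a x 1 := fun x k => by
    have h3 : (φ ^ (a (ψ x) k + a x 1)) x = (φ ^ a x (k + 1)) x := by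
      rw [zpow_add_apply, ← ha x 1, ← ha x (k + 1), zpow_one, ← ha, zpow_add_apply, zpow_one]
    have := hφ.zpow_injective h3
    omega
  have hbij : ∀ x, Function.Bijective (a x) := fun x => ⟨fun i j hij => by
    apply hψ.zpow_injective (x := x)
    rw [ha, ha, hij], hsurj x⟩
  let d : X → ℤ := fun x => netFlow (a x)
  have hd : Continuous d := continuous_netFlow hac h1 h2
  have hdψ : ∀ x, d (ψ x) = d x - 1 + a x 1 := fun x => by
    rw [← netFlow_shift (htop x) (hbot x) (hbij x) (a x 1)]
    exact congrArg netFlow (funext (hshift x))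
  let h : X → X := fun x => (φ ^ (-d x)) x
  have hh : ∀ x, h (ψ x) = φ (h x) := fun x => by
    change (φ ^ (-d (ψ x))) (ψ x) = φ ((φ ^ (-d x)) x)
    have h3 := ha x 1
    rw [zpow_one] at h3
    nth_rewrite 2 [h3]
    rw [← zpow_add_apply, apply_zpow_apply, hdψ]
    congr 2
    ring
  have hhk : ∀ (k : ℤ) x, h ((ψ ^ k) x) = (φ ^ k) (h x) := fun k => by
    induction k with
    | zero => simp
    | succ k ih => intro x; rw [zpow_add_apply, ih, zpow_add_apply, zpow_one, zpow_one, hh]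
    | pred k ih =>
      intro x
      have h3 : h x = φ (h (ψ⁻¹ x)) := by
        rw [← hh, ← Homeomorph.mul_apply, mul_inv_cancel, Homeomorph.one_apply]
      rw [zpow_sub_one, zpow_sub_one, Homeomorph.mul_apply, ih, h3, Homeomorph.mul_apply,
        ← Homeomorph.mul_apply φ⁻¹, inv_mul_cancel, Homeomorph.one_apply]
  have hinj : Function.Injective h := fun x y hxy => by
    have h3 : y = (φ ^ (d y - d x)) x := by
      rw [sub_eq_add_neg, zpow_add_apply]
      change y = (φ ^ d y) (h x)
      rw [hxy]
      change y = (φ ^ d y) ((φ ^ (-d y)) y)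
      rw [← zpow_add_apply]; simp
    obtain ⟨k, hk⟩ := hsurj x (d y - d x)
    rw [← hk, ← ha] at h3
    rw [h3, hhk] at hxy
    rw [h3, hφ _ _ hxy.symm, zpow_zero, Homeomorph.one_apply]
  have hhsurj : Function.Surjective h := fun z => ⟨(ψ ^ d z) z, by
    rw [hhk]
    change (φ ^ d z) ((φ ^ (-d z)) z) = z
    rw [← zpow_add_apply]; simp⟩
  let e : X ≃ X := Equiv.ofBijective h ⟨hinj, hhsurj⟩
  have he : Continuous e := continuous_zpow_apply φ hd.neg
  exact ⟨he.homeoOfEquivCompactToT2, hh⟩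

theorem IsFree.inv {φ : X ≃ₜ X} (hφ : IsFree φ) : IsFree φ⁻¹ := fun k x h => by
  rw [inv_zpow'] at h
  have := hφ _ _ h
  omega

theorem abs_le_of_increments {b : ℤ → ℤ} {C : ℤ} (h0 : b 0 = 0) (hC : ∀ j, |b (j + 1) - b j| ≤ C)
    (j : ℤ) : |b j| ≤ C * |j| := by
  have hC0 : 0 ≤ C := (abs_nonneg _).trans (hC 0)
  induction j with
  | zero => simp [h0]
  | succ j ih =>
    have h1 := abs_sub_abs_le_abs_sub (b (j + 1)) (b j)
    have h2 := hC j
    rw [Nat.abs_cast] at ih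
    rw [show |(j : ℤ) + 1| = j + 1 from abs_of_nonneg (by omega), mul_add]
    omega
  | pred j ih =>
    have h2 := hC (-j - 1)
    rw [sub_add_cancel, abs_sub_comm] at h2
    have h1 := abs_sub_abs_le_abs_sub (b (-j - 1)) (b (-j))
    rw [abs_neg, Nat.abs_cast] at ih
    rw [show |-(j : ℤ) - 1| = j + 1 by rw [abs_of_nonpos (by omega)]; omega, mul_add]
    omega

/-- Two minimal homeomorphisms lying in the topological full groups of each other are flip
conjugate. The assumption makes the permutation `k ↦ a k x` of `ℤ` defined by
`ψ ^ k x = φ ^ (a k x) x` a quasi-isometry, uniformly in `x`, so that it preserves or reverses the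
ends of `ℤ`. -/
theorem IsMinimal.flipConjugate [CompactSpace X] [T2Space X] [PerfectSpace X]
    {φ ψ : X ≃ₜ X} (hφ : IsMinimal φ) (hψ : IsMinimal ψ) (hψφ : ψ ∈ topologicalFullGroup φ)
    (hφψ : φ ∈ topologicalFullGroup ψ) : FlipConjugate ψ φ := by
  have hφf := hφ.isFree
  have hψf := hψ.isFree
  choose a hac ha using fun k : ℤ => (topologicalFullGroup φ).zpow_mem hψφ k
  choose b hbc hb using fun k : ℤ => (topologicalFullGroup ψ).zpow_mem hφψ k
  have hab : ∀ x j, a (b j x) x = j := fun x j => by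
    apply hφf.zpow_injective (x := x)
    rw [← ha, ← hb]
  have hba : ∀ x k, b (a k x) x = k := fun x k => by
    apply hψf.zpow_injective (x := x)
    rw [← hb, ← ha]
  have haadd : ∀ x k, a (k + 1) x = a 1 ((ψ ^ k) x) + a k x := fun x k => by
    apply hφf.zpow_injective (x := x)
    rw [zpow_add_apply, ← ha, ← ha, ← ha, add_comm, zpow_add_apply]
  have hbadd : ∀ x k, b (k + 1) x = b 1 ((φ ^ k) x) + b k x := fun x k => by
    apply hψf.zpow_injective (x := x)
    rw [zpow_add_apply, ← hb, ← hb, ← hb, add_comm, zpow_add_apply]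
  obtain ⟨C, hC⟩ := exists_int_bound (hac 1)
  obtain ⟨C', hC'⟩ := exists_int_bound (hbc 1)
  have hb0 : ∀ x, b 0 x = 0 := fun x => hψf _ x (by rw [← hb]; simp)
  have hlin : ∀ x k, |k| ≤ C' * |a k x| := fun x k => by
    have := abs_le_of_increments (b := fun j => b j x) (hb0 x)
      (fun j => by rw [hbadd, add_sub_cancel_right]; exact hC' _) (a k x)
    rwa [hba] at this
  have hsurj : ∀ x, Function.Surjective fun k => a k x := fun x j => ⟨_, hab x j⟩
  have hinj : ∀ x, Function.Injective fun k => a k x := fun x i j hij => by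
    rw [← hba x i, ← hba x j]
    exact congrArg (b · x) hij
  have hends := fun x => ends_of_bounded_increments (a := fun k => a k x) ⟨hinj x, hsurj x⟩
    (fun k => by rw [haadd, add_sub_cancel_right]; exact hC _) (hlin x)
  generalize C' * C + 1 = M at hends
  -- Whether `ψ` preserves or reverses the ends of an orbit does not depend on the orbit.
  have hpos : ∀ x, 0 < a M x ↔ Tendsto (fun k => a k x) atTop atTop := fun x => by
    rcases hends x with ⟨h1, h2⟩ | ⟨h1, h2⟩
    · exact ⟨fun _ => (tendsto_of_linear_bound (hlin x) h1 h2).1, fun _ => h1 M le_rfl⟩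
    · refine ⟨fun h => absurd h (h1 M le_rfl).not_gt, fun h => ?_⟩
      obtain ⟨k, hk, hk'⟩ := ((h.eventually_gt_atTop 0).and (eventually_ge_atTop M)).exists
      exact absurd hk (h1 k hk').not_gt
  have hinv : ∀ x, 0 < a M (ψ x) ↔ 0 < a M x := fun x => by
    have hsh : (fun k => a k (ψ x)) = fun k => a (k + 1) x + -a 1 x := funext fun k => by
      rw [eq_add_neg_iff_add_eq]
      apply hφf.zpow_injective (x := x)
      rw [zpow_add_apply, ← ha, zpow_one, ← ha, ← ha, zpow_add_apply, zpow_one]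
    rw [hpos, hpos, hsh]
    refine ⟨fun h => ?_, fun h => tendsto_atTop_add_const_right _ _
      (h.comp (tendsto_atTop_add_const_right _ 1 tendsto_id))⟩
    have := (tendsto_atTop_add_const_right _ (a 1 x) h).comp
      (tendsto_atTop_add_const_right _ (-1) tendsto_id)
    refine this.congr fun k => ?_
    simp
  rcases hψ.eq_empty_or_univ (P := {x | 0 < a M x})
    ((isClopen_discrete (Ioi (0 : ℤ))).preimage (hac M)) hinv with h | h
  · have hneg : ∀ x, ¬ 0 < a M x := fun x hx => (h ▸ hx : x ∈ (∅ : Set X))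
    have hends' : ∀ x, (∀ k, M ≤ k → a k x < 0) ∧ ∀ k, k ≤ -M → 0 < a k x := fun x =>
      (hends x).resolve_left fun h => hneg x (h.1 M le_rfl)
    have ht := fun x => tendsto_of_linear_bound (a := fun k => -a k x) (C' := C') (M := M)
      (fun k => by rw [abs_neg]; exact hlin x k) (fun k hk => neg_pos.2 ((hends' x).1 k hk))
      (fun k hk => neg_lt_zero.2 ((hends' x).2 k hk))
    obtain ⟨H, hH⟩ := exists_conj_of_oriented hφf.inv hψf (a := fun x k => -a k x)
      (fun k => (hac k).neg) (fun x k => by rw [inv_zpow, zpow_neg, inv_inv, ha])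
      (fun x j => ⟨b (-j) x, by simp only [hab, neg_neg]⟩) (fun x => (ht x).1) (fun x => (ht x).2)
      (M := M) (fun x k hk => (neg_pos.2 ((hends' x).1 k hk)).le)
      (fun x k hk => neg_lt_zero.2 ((hends' x).2 k hk))
    exact ⟨H, Or.inr fun y => by rw [hH, H.apply_symm_apply]; rfl⟩
  · have hp : ∀ x, 0 < a M x := fun x => (h ▸ mem_univ x : x ∈ {x | 0 < a M x})
    have hends' : ∀ x, (∀ k, M ≤ k → 0 < a k x) ∧ ∀ k, k ≤ -M → a k x < 0 := fun x =>
      (hends x).resolve_right fun h => (hp x).not_gt (h.1 M le_rfl)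
    have ht := fun x => tendsto_of_linear_bound (hlin x) (hends' x).1 (hends' x).2
    obtain ⟨H, hH⟩ := exists_conj_of_oriented hφf hψf (a := fun x k => a k x)
      hac (fun x k => ha k x) hsurj (fun x => (ht x).1) (fun x => (ht x).2)
      (M := M) (fun x k hk => ((hends' x).1 k hk).le) (fun x k hk => (hends' x).2 k hk)
    exact ⟨H, Or.inl fun y => by rw [hH, H.apply_symm_apply]⟩

end Boyle

/-! ### The index of an element of the topological full group -/

section Index

open Filter

variable {X : Type*} [TopologicalSpace X]

/-- An element of `[[φ]]` with cocycle `n` permutes each orbit, identified with `ℤ`, by the rule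
`k ↦ k + n (φ ^ k x)`. -/
theorem IsFree.bijective_add_cocycle {φ f : X ≃ₜ X} (hφ : IsFree φ) {n : X → ℤ}
    (hf : IsCocycle φ f n) (x : X) : Function.Bijective fun k : ℤ => k + n ((φ ^ k) x) := by
  have hfk : ∀ k : ℤ, f ((φ ^ k) x) = (φ ^ (k + n ((φ ^ k) x))) x := fun k => by
    rw [hf, add_comm k, zpow_add_apply]
  refine ⟨fun i j hij => ?_, fun j => ?_⟩
  · apply hφ.zpow_injective (x := x)
    apply f.injective
    rw [hfk, hfk]
    exact congrArg (fun k => (φ ^ k) x) hij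
  · have h1 := hf.inv ((φ ^ j) x)
    rw [← zpow_add_apply] at h1
    refine ⟨-n (f⁻¹ ((φ ^ j) x)) + j, ?_⟩
    simp only [← h1]
    ring

theorem tendsto_add_of_bounded {e : ℤ → ℤ} {C : ℤ} (hC : ∀ k, |e k| ≤ C) :
    Tendsto (fun k => k + e k) atTop atTop ∧ Tendsto (fun k => k + e k) atBot atBot :=
  ⟨tendsto_atTop_add_right_of_le _ (-C) tendsto_id fun k => (abs_le.1 (hC k)).1,
    tendsto_atBot_add_right_of_ge _ C tendsto_id fun k => (abs_le.1 (hC k)).2⟩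

theorem sum_nonnegInd_sub_add {m M : ℤ} (hm : |m| < M) :
    ∑ k ∈ Finset.Icc (-|M|) |M|, (nonnegInd k - nonnegInd (k + m)) = -m := by
  have h := abs_lt.1 hm
  rw [← netFlow_eq_sum (a := fun k => k + m) (fun k hk => by omega) (fun k hk => by omega)]
  have h1 := netFlow_sub (a := fun k => k) tendsto_id tendsto_id Function.bijective_id (-m)
  have h2 : netFlow (fun k => k) = 0 := by simp [netFlow]
  simpa [h2] using h1

/-- The integral of the cocycle of an element `f` of `[[φ]]` is an integer which does not depend on
the invariant measure: up to the sign it is the net flow across the origin of the permutation that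
`f` induces on an orbit. This net flow is a continuous invariant function, hence constant. -/
theorem IsMinimal.exists_integral_eq [CompactSpace X] [T2Space X] [PerfectSpace X] [Nonempty X]
    [MeasurableSpace X] [BorelSpace X] {φ f : X ≃ₜ X} (hφ : IsMinimal φ) {n : X → ℤ}
    (hn : Continuous n) (hf : IsCocycle φ f n) :
    ∃ N : ℤ, ∀ (μ : Measure X) [IsProbabilityMeasure μ], MeasurePreserving φ μ μ →
      ∫ x, (n x : ℝ) ∂μ = N := by
  obtain ⟨C, hC⟩ := exists_int_bound hn
  let σ : X → ℤ → ℤ := fun x k => k + n ((φ ^ k) x)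
  have ht := fun x => tendsto_add_of_bounded (e := fun k => n ((φ ^ k) x)) fun k => hC _
  have h1 : ∀ x k, C + 1 ≤ k → 0 ≤ σ x k := fun x k hk => by
    have := abs_le.1 (hC ((φ ^ k) x)); simp only [σ]; omega
  have h2 : ∀ x k, k ≤ -(C + 1) → σ x k < 0 := fun x k hk => by
    have := abs_le.1 (hC ((φ ^ k) x)); simp only [σ]; omega
  have hσc : ∀ k, Continuous fun x => σ x k := fun k =>
    continuous_const.add (hn.comp (φ ^ k).continuous)
  have hinv : ∀ x, netFlow (σ (φ x)) = netFlow (σ x) := fun x => by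
    have h3 := netFlow_shift (ht x).1 (ht x).2 (hφ.isFree.bijective_add_cocycle hf x) 1
    rw [sub_add_cancel] at h3
    rw [← h3]
    refine congrArg netFlow (funext fun k => ?_)
    simp only [σ]
    rw [zpow_add_apply, zpow_one]
    ring
  let x₀ : X := Classical.arbitrary X
  have hconst : ∀ x, netFlow (σ x) = netFlow (σ x₀) := fun x =>
    hφ.constant (continuous_netFlow hσc h1 h2) hinv x x₀
  refine ⟨-netFlow (σ x₀), fun μ _ hμ => ?_⟩
  have hterm : ∀ k : ℤ, Continuous fun x => nonnegInd k - nonnegInd (k + n x) := fun k =>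
    (continuous_of_discreteTopology (f := fun m => nonnegInd k - nonnegInd (k + m))).comp hn
  have hint : ∀ k : ℤ, ∫ x, ((nonnegInd k - nonnegInd (σ x k) : ℤ) : ℝ) ∂μ =
      ∫ x, ((nonnegInd k - nonnegInd (k + n x) : ℤ) : ℝ) ∂μ := fun k =>
    (measurePreserving_zpow hμ k).integral_comp (φ ^ k).measurableEmbedding
      (fun x => ((nonnegInd k - nonnegInd (k + n x) : ℤ) : ℝ))
  have hflow : ∫ x, ((netFlow (σ x) : ℤ) : ℝ) ∂μ = -∫ x, (n x : ℝ) ∂μ := by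
    calc ∫ x, ((netFlow (σ x) : ℤ) : ℝ) ∂μ
        = ∫ x, ∑ k ∈ Finset.Icc (-|C + 1|) |C + 1|,
            ((nonnegInd k - nonnegInd (σ x k) : ℤ) : ℝ) ∂μ := by
          simp only [fun x => netFlow_eq_sum (h1 x) (h2 x), Int.cast_sum]
      _ = ∫ x, ∑ k ∈ Finset.Icc (-|C + 1|) |C + 1|,
            ((nonnegInd k - nonnegInd (k + n x) : ℤ) : ℝ) ∂μ := by
          rw [integral_finsetSum, integral_finsetSum, Finset.sum_congr rfl fun k _ => hint k]
          · exact fun k _ => integrable_of_continuous_int μ (hterm k)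
          · exact fun k _ => integrable_of_continuous_int μ ((hterm k).comp (φ ^ k).continuous)
      _ = ∫ x, -(n x : ℝ) ∂μ := by
          refine integral_congr_ae (ae_of_all _ fun x => ?_)
          have := sum_nonnegInd_sub_add (Int.lt_add_one_of_le (hC x))
          simp only [← Int.cast_sum, this, Int.cast_neg]
      _ = _ := integral_neg _
  simp only [hconst, integral_const, probReal_univ, one_smul] at hflow
  push_cast
  linarith

end Index

/-! ### Flip conjugacy and isomorphism of groups -/

section Conjugation

variable {X Y : Type*} [TopologicalSpace X] [TopologicalSpace Y]

/-- Conjugation by a homeomorphism `F`, as an isomorphism of homeomorphism groups. -/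
def conjHomeo (F : X ≃ₜ Y) : (X ≃ₜ X) ≃* (Y ≃ₜ Y) where
  toFun g := (F.symm.trans g).trans F
  invFun g := (F.trans g).trans F.symm
  left_inv g := Homeomorph.ext fun x => by simp
  right_inv g := Homeomorph.ext fun x => by simp
  map_mul' g h := Homeomorph.ext fun x => by simp

theorem conjHomeo_apply (F : X ≃ₜ Y) (g : X ≃ₜ X) (y : Y) :
    conjHomeo F g y = F (g (F.symm y)) := rfl

theorem conjHomeo_symm (F : X ≃ₜ Y) : (conjHomeo F).symm = conjHomeo F.symm := rfl

theorem flipConjugate_iff {φ : X ≃ₜ X} {ψ : Y ≃ₜ Y} : FlipConjugate φ ψ ↔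
    ∃ F : X ≃ₜ Y, conjHomeo F φ = ψ ∨ conjHomeo F φ = ψ⁻¹ := by
  simp only [FlipConjugate, Homeomorph.ext_iff, conjHomeo_apply, Homeomorph.inv_apply]

theorem conjHomeo_symm_flip {F : X ≃ₜ Y} {φ : X ≃ₜ X} {ψ : Y ≃ₜ Y}
    (h : conjHomeo F φ = ψ ∨ conjHomeo F φ = ψ⁻¹) :
    conjHomeo F.symm ψ = φ ∨ conjHomeo F.symm ψ = φ⁻¹ := by
  rw [← conjHomeo_symm]
  refine h.imp (fun h => ?_) fun h => ?_
  · rw [← h, MulEquiv.symm_apply_apply]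
  · rw [← inv_inv ψ, ← h, map_inv, MulEquiv.symm_apply_apply]

theorem IsCocycle.conj {φ f : X ≃ₜ X} {n : X → ℤ} (h : IsCocycle φ f n) (F : X ≃ₜ Y) :
    IsCocycle (conjHomeo F φ) (conjHomeo F f) (fun y => n (F.symm y)) := fun y => by
  rw [← map_zpow, conjHomeo_apply, conjHomeo_apply, ← h]

theorem IsCocycle.of_inv {φ f : X ≃ₜ X} {n : X → ℤ} (h : IsCocycle φ⁻¹ f n) :
    IsCocycle φ f (fun x => -n x) := fun x => by
  rw [h x, inv_zpow']

theorem conjHomeo_mem_topologicalFullGroup {F : X ≃ₜ Y} {φ : X ≃ₜ X} {ψ : Y ≃ₜ Y}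
    (h : conjHomeo F φ = ψ ∨ conjHomeo F φ = ψ⁻¹) {f : X ≃ₜ X} (hf : f ∈ topologicalFullGroup φ) :
    conjHomeo F f ∈ topologicalFullGroup ψ := by
  obtain ⟨n, hn, hfn⟩ := hf
  have hc := hfn.conj F
  have hn' : Continuous fun y => n (F.symm y) := hn.comp F.symm.continuous
  rcases h with h | h <;> rw [h] at hc
  · exact ⟨_, hn', hc⟩
  · exact ⟨_, hn'.neg, hc.of_inv⟩

/-- The transported cocycle has integral zero for the given measure `ν` because it has integral
zero for the image of `μ` and its integral does not depend on the invariant measure. -/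
theorem conjHomeo_mem_topologicalFullGroupZero [CompactSpace X] [MeasurableSpace X] [BorelSpace X]
    [CompactSpace Y] [T2Space Y] [PerfectSpace Y] [Nonempty Y] [MeasurableSpace Y] [BorelSpace Y]
    {F : X ≃ₜ Y} {φ : X ≃ₜ X} {ψ : Y ≃ₜ Y} (hψ : IsMinimal ψ)
    (h : conjHomeo F φ = ψ ∨ conjHomeo F φ = ψ⁻¹)
    (μ : Measure X) [IsProbabilityMeasure μ] (hμ : MeasurePreserving φ μ μ)
    (ν : Measure Y) [IsProbabilityMeasure ν] (hν : MeasurePreserving ψ ν ν)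
    {f : X ≃ₜ X} (hf : f ∈ topologicalFullGroupZero φ μ hμ) :
    conjHomeo F f ∈ topologicalFullGroupZero ψ ν hν := by
  obtain ⟨n, hn, hfn, hn0⟩ := hf
  have hF : MeasurePreserving F μ (μ.map F) := ⟨F.continuous.measurable, rfl⟩
  have : IsProbabilityMeasure (μ.map F) := 
    Measure.isProbabilityMeasure_map F.continuous.aemeasurable
  have hFs : MeasurePreserving F.symm (μ.map F) μ := hF.symm F.toMeasurableEquiv
  have hconj : MeasurePreserving (conjHomeo F φ) (μ.map F) (μ.map F) := hF.comp (hμ.comp hFs)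
  have hψF : MeasurePreserving ψ (μ.map F) (μ.map F) := by
    rcases h with h | h
    · rwa [h] at hconj
    · rw [h] at hconj
      have h3 : MeasurePreserving ψ⁻¹.symm (μ.map F) (μ.map F) :=
        hconj.symm (ψ⁻¹ : Y ≃ₜ Y).toMeasurableEquiv
      exact h3
  have hint : ∫ y, (n (F.symm y) : ℝ) ∂(μ.map F) = 0 := by
    rw [← hn0]
    exact hFs.integral_comp F.symm.measurableEmbedding fun x => (n x : ℝ)
  have hc := hfn.conj F
  have hn' : Continuous fun y => n (F.symm y) := hn.comp F.symm.continuous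
  have key : ∀ m : Y → ℤ, Continuous m → IsCocycle ψ (conjHomeo F f) m →
      ∫ y, (m y : ℝ) ∂(μ.map F) = 0 → conjHomeo F f ∈ topologicalFullGroupZero ψ ν hν :=
    fun m hm hmc hm0 => by
      obtain ⟨N, hN⟩ := hψ.exists_integral_eq hm hmc
      exact ⟨m, hm, hmc, by rw [hN ν hν, ← hN _ hψF, hm0]⟩
  rcases h with h | h <;> rw [h] at hc
  · exact key _ hn' hc hint
  · refine key _ hn'.neg hc.of_inv ?_
    calc ∫ y, ((-n (F.symm y) : ℤ) : ℝ) ∂(μ.map F) = ∫ y, -(n (F.symm y) : ℝ) ∂(μ.map F) := by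
          simp only [Int.cast_neg]
      _ = 0 := by rw [integral_neg, hint, neg_zero]

theorem IsMinimal.conj {φ : X ≃ₜ X} (hφ : IsMinimal φ) (F : X ≃ₜ Y) :
    IsMinimal (conjHomeo F φ) := fun y => by
  refine (F.surjective.denseRange.dense_image F.continuous (hφ (F.symm y))).mono ?_
  rintro _ ⟨_, ⟨k, rfl⟩, rfl⟩
  exact ⟨k, by rw [← map_zpow]; rfl⟩

theorem conjHomeo_mem_of_equivariant [CompactSpace X] [T2Space X] [TotallyDisconnectedSpace X]
    {φ : X ≃ₜ X} (hφ : IsFree φ) {ψ : Y ≃ₜ Y} (hψ : IsFree ψ)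
    {Γ : Subgroup (X ≃ₜ X)} (hΓ : ⁅topologicalFullGroup φ, topologicalFullGroup φ⁆ ≤ Γ)
    {Δ : Subgroup (Y ≃ₜ Y)} (hΔ : Δ ≤ topologicalFullGroup ψ) {F : X ≃ₜ Y}
    (hF : ∀ g ∈ Γ, conjHomeo F g ∈ Δ) : conjHomeo F φ ∈ topologicalFullGroup ψ := by
  refine hψ.mem_topologicalFullGroup_of_eventuallyEq fun y => ?_
  -- Near each point, `φ` agrees with a `3`-cycle.
  obtain ⟨c, hc, -, hcφ, -⟩ := exists_threeCycle hφ isOpen_univ (x := F.symm y) (i := 1) (j := 2)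
    (mem_univ _) (mem_univ _) (mem_univ _) one_ne_zero two_ne_zero (by norm_num)
  refine ⟨conjHomeo F c, hΔ (hF c (hΓ hc)), ?_⟩
  filter_upwards [F.symm.continuous.continuousAt.eventually hcφ] with z hz
  rw [conjHomeo_apply, conjHomeo_apply, hz, zpow_one]

/-- An isomorphism between groups lying between `D([[φ]])` and `[[φ]]` entails flip conjugacy. -/
theorem IsMinimal.flipConjugate_of_mulEquiv [CompactSpace X] [T2Space X]
    [TotallyDisconnectedSpace X] [PerfectSpace X] [CompactSpace Y] [T2Space Y]
    [TotallyDisconnectedSpace Y] [PerfectSpace Y] [Nonempty Y]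
    {φ : X ≃ₜ X} (hφ : IsMinimal φ) {ψ : Y ≃ₜ Y} (hψ : IsMinimal ψ)
    {Γ : Subgroup (X ≃ₜ X)} (hΓ : ⁅topologicalFullGroup φ, topologicalFullGroup φ⁆ ≤ Γ)
    (hΓ' : Γ ≤ topologicalFullGroup φ)
    {Δ : Subgroup (Y ≃ₜ Y)} (hΔ : ⁅topologicalFullGroup ψ, topologicalFullGroup ψ⁆ ≤ Δ)
    (hΔ' : Δ ≤ topologicalFullGroup ψ) (α : Γ ≃* Δ) : FlipConjugate φ ψ := by
  obtain ⟨F, hF⟩ := (hφ.isRich hΓ' hΓ).exists_homeomorph (hψ.isRich hΔ' hΔ) α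
  have hF1 : ∀ g : Γ, conjHomeo F g.1 = (α g).1 := fun g => Homeomorph.ext fun y => by
    rw [conjHomeo_apply, hF, F.apply_symm_apply]
  have hF2 : ∀ g : Δ, conjHomeo F.symm g.1 = (α.symm g).1 := fun g => by
    rw [← conjHomeo_symm, MulEquiv.symm_apply_eq, hF1, α.apply_symm_apply]
  have h1 : conjHomeo F φ ∈ topologicalFullGroup ψ :=
    conjHomeo_mem_of_equivariant hφ.isFree hψ.isFree hΓ hΔ' fun g hg => hF1 ⟨g, hg⟩ ▸ (α ⟨g, hg⟩).2
  have h2 : conjHomeo F.symm ψ ∈ topologicalFullGroup φ :=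
    conjHomeo_mem_of_equivariant hψ.isFree hφ.isFree hΔ hΓ' fun g hg =>
      hF2 ⟨g, hg⟩ ▸ (α.symm ⟨g, hg⟩).2
  have h3 := conjHomeo_mem_topologicalFullGroup (F := F) (Or.inl rfl) h2
  rw [← conjHomeo_symm, MulEquiv.apply_symm_apply] at h3
  obtain ⟨H, hH⟩ := hψ.flipConjugate (hφ.conj F) h1 h3
  exact ⟨F.trans H, hH⟩

end Conjugation

section Groups

/-- An isomorphism of groups restricts to subgroups which it and its inverse map into each other. -/
def subgroupEquivOfMapsTo {G H : Type*} [Group G] [Group H] (e : G ≃* H) (A : Subgroup G)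
    (B : Subgroup H) (hA : ∀ a ∈ A, e a ∈ B) (hB : ∀ b ∈ B, e.symm b ∈ A) : A ≃* B where
  toFun a := ⟨e a, hA a a.2⟩
  invFun b := ⟨e.symm b, hB b b.2⟩
  left_inv a := Subtype.ext (e.symm_apply_apply a)
  right_inv b := Subtype.ext (e.apply_symm_apply b)
  map_mul' a b := Subtype.ext (map_mul e a.1 b.1)

theorem map_mem_commutator {G H : Type*} [Group G] [Group H] (f : G →* H) {g : G}
    (hg : g ∈ commutator G) : f g ∈ commutator H := by
  have h1 := Subgroup.mem_map_of_mem f hg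
  rw [commutator_def, Subgroup.map_commutator] at h1
  exact Subgroup.commutator_mono le_top le_top h1

theorem nonempty_commutator_mulEquiv {G H : Type*} [Group G] [Group H] (e : G ≃* H) :
    Nonempty (commutator G ≃* commutator H) :=
  ⟨subgroupEquivOfMapsTo e _ _ (fun _ h => map_mem_commutator e.toMonoidHom h)
    fun _ h => map_mem_commutator e.symm.toMonoidHom h⟩

variable {X : Type*} [TopologicalSpace X] [CompactSpace X] [MeasurableSpace X] [BorelSpace X]

theorem topologicalFullGroupZero_le {φ : X ≃ₜ X} {μ : Measure X} [IsProbabilityMeasure μ]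
    {hμ : MeasurePreserving φ μ μ} : topologicalFullGroupZero φ μ hμ ≤ topologicalFullGroup φ := by
  rintro f ⟨n, hn, hf, -⟩
  exact ⟨n, hn, hf⟩

/-- The integral of the cocycle is additive, so it vanishes on commutators. -/
theorem commutator_le_topologicalFullGroupZero {φ : X ≃ₜ X} {μ : Measure X}
    [IsProbabilityMeasure μ] {hμ : MeasurePreserving φ μ μ} :
    ⁅topologicalFullGroup φ, topologicalFullGroup φ⁆ ≤ topologicalFullGroupZero φ μ hμ := by
  let P : (X ≃ₜ X) → ℝ → Prop := fun f r =>
    ∃ n : X → ℤ, Continuous n ∧ IsCocycle φ f n ∧ ∫ x, (n x : ℝ) ∂μ = r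
  have hmul : ∀ f g r s, P f r → P g s → P (f * g) (r + s) := by
    rintro f g r s ⟨m, hm, hf, rfl⟩ ⟨n, hn, hg, rfl⟩
    refine ⟨fun x => m (g x) + n x, (hm.comp g.continuous).add hn, hf.mul hg, ?_⟩
    have h1 : ∫ x, (m (g x) : ℝ) ∂μ = ∫ x, (m x : ℝ) ∂μ :=
      (hg.measurePreserving hn hμ).integral_comp g.measurableEmbedding (fun x => (m x : ℝ))
    have h2 : Integrable (fun x => (m (g x) : ℝ)) μ :=
      integrable_of_continuous_int μ (hm.comp g.continuous)
    push_cast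
    rw [integral_add h2 (integrable_of_continuous_int μ hn), h1]
  have hinv : ∀ f r, P f r → P f⁻¹ (-r) := by
    rintro f r ⟨n, hn, hf, rfl⟩
    refine ⟨fun x => -n (f⁻¹ x), (hn.comp (f⁻¹).continuous).neg, hf.inv, ?_⟩
    have h1 : ∫ x, (n ((f⁻¹ : X ≃ₜ X) x) : ℝ) ∂μ = ∫ x, (n x : ℝ) ∂μ :=
      (hf.inv.measurePreserving (hn.comp (f⁻¹).continuous).neg hμ).integral_comp
        (f⁻¹).measurableEmbedding (fun x => (n x : ℝ))
    push_cast
    rw [integral_neg, h1]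
  refine Subgroup.commutator_le.2 ?_
  rintro f ⟨m, hm, hf⟩ g ⟨n, hn, hg⟩
  have hPf : P f _ := ⟨m, hm, hf, rfl⟩
  have hPg : P g _ := ⟨n, hn, hg, rfl⟩
  have h := hmul _ _ _ _ (hmul _ _ _ _ (hmul _ _ _ _ hPf hPg) (hinv _ _ hPf)) (hinv _ _ hPg)
  have h0 : P ⁅f, g⁆ 0 := by
    rwa [add_neg_cancel_comm, add_neg_cancel] at h
  exact h0

end Groups

end CantorMinimal

open CantorMinimal

theorem mainTheorem3
    {X₁ : Type*} [TopologicalSpace X₁] [CompactSpace X₁] [TopologicalSpace.MetrizableSpace X₁]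
    [TotallyDisconnectedSpace X₁] [PerfectSpace X₁] [Nonempty X₁]
    [MeasurableSpace X₁] [BorelSpace X₁]
    {X₂ : Type*} [TopologicalSpace X₂] [CompactSpace X₂] [TopologicalSpace.MetrizableSpace X₂]
    [TotallyDisconnectedSpace X₂] [PerfectSpace X₂] [Nonempty X₂]
    [MeasurableSpace X₂] [BorelSpace X₂]
    (φ₁ : X₁ ≃ₜ X₁) (hφ₁ : CantorMinimal.IsMinimal φ₁)
    (φ₂ : X₂ ≃ₜ X₂) (hφ₂ : CantorMinimal.IsMinimal φ₂) :
    (CantorMinimal.FlipConjugate φ₁ φ₂ ↔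
      Nonempty (commutator (CantorMinimal.topologicalFullGroup φ₁) ≃*
        commutator (CantorMinimal.topologicalFullGroup φ₂))) ∧
    (∀ (μ₁ : MeasureTheory.Measure X₁) [MeasureTheory.IsProbabilityMeasure μ₁]
        (hμ₁ : MeasureTheory.MeasurePreserving φ₁ μ₁ μ₁)
        (μ₂ : MeasureTheory.Measure X₂) [MeasureTheory.IsProbabilityMeasure μ₂]
        (hμ₂ : MeasureTheory.MeasurePreserving φ₂ μ₂ μ₂),
      CantorMinimal.FlipConjugate φ₁ φ₂ ↔
        Nonempty (CantorMinimal.topologicalFullGroupZero φ₁ μ₁ hμ₁ ≃*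
          CantorMinimal.topologicalFullGroupZero φ₂ μ₂ hμ₂)) ∧
    (CantorMinimal.FlipConjugate φ₁ φ₂ ↔
      Nonempty (CantorMinimal.topologicalFullGroup φ₁ ≃*
        CantorMinimal.topologicalFullGroup φ₂)) := by
  have hfull : FlipConjugate φ₁ φ₂ →
      Nonempty (topologicalFullGroup φ₁ ≃* topologicalFullGroup φ₂) := fun h => by
    obtain ⟨F, hF⟩ := flipConjugate_iff.1 h
    exact ⟨subgroupEquivOfMapsTo (conjHomeo F) _ _
      (fun f hf => conjHomeo_mem_topologicalFullGroup hF hf)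
      fun f hf => conjHomeo_mem_topologicalFullGroup (conjHomeo_symm_flip hF) hf⟩
  refine ⟨⟨fun h => nonempty_commutator_mulEquiv (hfull h).some, fun ⟨α⟩ => ?_⟩,
    fun μ₁ _ hμ₁ μ₂ _ hμ₂ => ⟨fun h => ?_, fun ⟨α⟩ => ?_⟩, ⟨hfull, fun ⟨α⟩ => ?_⟩⟩
  · have e₁ := (commutator (topologicalFullGroup φ₁)).equivMapOfInjective
      (topologicalFullGroup φ₁).subtype (topologicalFullGroup φ₁).subtype_injective
    have e₂ := (commutator (topologicalFullGroup φ₂)).equivMapOfInjective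
      (topologicalFullGroup φ₂).subtype (topologicalFullGroup φ₂).subtype_injective
    rw [Subgroup.map_subtype_commutator] at e₁ e₂
    exact hφ₁.flipConjugate_of_mulEquiv hφ₂ le_rfl (Subgroup.commutator_le_self _) le_rfl
      (Subgroup.commutator_le_self _) ((e₁.symm.trans α).trans e₂)
  · obtain ⟨F, hF⟩ := flipConjugate_iff.1 h
    exact ⟨subgroupEquivOfMapsTo (conjHomeo F) _ _
      (fun f hf => conjHomeo_mem_topologicalFullGroupZero hφ₂ hF μ₁ hμ₁ μ₂ hμ₂ hf)
      fun f hf => conjHomeo_mem_topologicalFullGroupZero hφ₁ (conjHomeo_symm_flip hF)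
        μ₂ hμ₂ μ₁ hμ₁ hf⟩
  · exact hφ₁.flipConjugate_of_mulEquiv hφ₂ commutator_le_topologicalFullGroupZero
      topologicalFullGroupZero_le commutator_le_topologicalFullGroupZero
      topologicalFullGroupZero_le α
  · exact hφ₁.flipConjugate_of_mulEquiv hφ₂ (Subgroup.commutator_le_self _) le_rfl
      (Subgroup.commutator_le_self _) le_rfl α
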